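/- Let $n\ge 1$ and let $\mathfrak S_n$ be the group of permutations of $\{1,\dots,n\}$, with product $\sigma\mu=\sigma\circ\mu$, simple transpositions $s_i=(i,i+1)$, length $\ell$ (the least number of factors in a product of simple transpositions), and maximal permutation $\omega=n\,(n-1)\cdots 1$. A transposition $\tau$ is a Bruhat transposition for $\sigma$ if $\ell(\sigma\tau)=\ell(\sigma)+1$; the Bruhat order $\le$ is the reflexive transitive closure of the relations $\sigma<\sigma\tau$ so obtained. Let $(K_\sigma)_{\sigma\in\mathfrak S_n}$ be the basis of a free module (over any nonzero commutative ring), with right operators $\pi_i,\hat\pi_i$ ($1\le i<n$) defined by $K_\sigma\pi_i=K_{\sigma s_i}$ if $\sigma(i)>\sigma(i+1)$, $K_\sigma\pi_i=K_\sigma$ otherwise, and $\hat\pi_i=\pi_i-1$; for a reduced decomposition $\tau=s_{i_1}\cdots s_{i_r}$ put $\pi_\tau=\pi_{i_1}\cdots\pi_{i_r}$ and $\hat\pi_\tau=\hat\pi_{i_1}\cdots\hat\pi_{i_r}$. Let $1\le k_1<k_2<\dots<k_m<n$, $k_0=0$, and $\sigma\in\mathfrak S_n$. Let $\mathcal W_i$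 be the list of the transpositions $(a,b)$ with $k_{i-1}<a\le k_i<b\le n$, ordered by increasing $a$ and, for equal $a$, by decreasing $b$, and let $\mathcal W_{(k_1,\dots,k_m)}$ be the concatenation of $\mathcal W_m,\mathcal W_{m-1},\dots,\mathcal W_1$ in this order. Call a subword $w=\tau_1\cdots\tau_r$ of $\mathcal W_{(k_1,\dots,k_m)}$ valid if each $\tau_j$ is a Bruhat transposition for $\sigma\tau_1\cdots\tau_{j-1}$; write $|w|=r$ and $\sigma w=\sigma\tau_1\cdots\tau_r$. The coset $\sigma(\mathfrak S_{k_1}\times\mathfrak S_{k_2-k_1}\times\dots\times\mathfrak S_{n-k_m})$ has a unique maximal element $\zeta$ for the Bruhat order, and $$K_\omega\,\hat\pi_{\omega\zeta}\,\pi_{\zeta^{-1}\sigma}=\sum_{w\text{ valid}}(-1)^{|w|}K_{\sigma w},$$ for any choice of the reduced decompositions of $\omega\zeta$ and $\zeta^{-1}\sigma$. This sum has no cancellation: each permutation equals $\sigma w$ for at most one valid $w$. Its coefficients on the set $\{\sigma w : w\text{ valid}\}$ are all $1$ or $-1$, and this set is closed under intervals: if $\nu_1\le\mu\le\nu_2$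 and $\nu_1,\nu_2$ belong to it, so does $\mu$. In general this set is not an interval: there are $n$, $k_1<\dots<k_m$ and $\sigma\in\mathfrak S_n$ for which it is not of the form $\{\mu:\alpha\le\mu\le\beta\}$. -/

import Mathlib

namespace ZeroHecke

/-! Permutations of `{1, …, n}` are `Equiv.Perm (Fin n)`: the position (or value)
`p ∈ {1, …, n}` is the element of `Fin n` with underlying natural number `p - 1`.  The product `σ * τ` is
`σ ∘ τ`, so multiplying by a transposition on the right exchanges two positions. -/

/-- The simple transposition exchanging the (0-indexed) positions `i` and `i + 1`. -/
def simple {n : ℕ} (i : Fin (n - 1)) : Equiv.Perm (Fin n) :=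
  Equiv.swap ⟨i.val, by omega⟩ ⟨i.val + 1, by omega⟩

/-- The permutation `s_{i₁} s_{i₂} ⋯ s_{iᵣ}` of a word `i₁ i₂ … iᵣ`. -/
def wordProd {n : ℕ} (u : List (Fin (n - 1))) : Equiv.Perm (Fin n) :=
  (u.map simple).prod

/-- The length of a permutation: the least number of factors in a decomposition of it as a product
of simple transpositions. -/
noncomputable def len {n : ℕ} (σ : Equiv.Perm (Fin n)) : ℕ :=
  sInf {r | ∃ u : List (Fin (n - 1)), wordProd u = σ ∧ u.length = r}

/-- `u` is a reduced decomposition of `σ`. -/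
def IsReducedWord {n : ℕ} (u : List (Fin (n - 1))) (σ : Equiv.Perm (Fin n)) : Prop :=
  wordProd u = σ ∧ u.length = len σ

/-- Every permutation is a product of simple transpositions (so `len` is a true minimum). -/
theorem exists_word {n : ℕ} (σ : Equiv.Perm (Fin n)) :
    ∃ u : List (Fin (n - 1)), wordProd u = σ := by
  rcases n with _ | n
  · exact ⟨[], Subsingleton.elim _ _⟩
  · have h : σ ∈ Submonoid.closure
        (Set.range fun i : Fin n => Equiv.swap i.castSucc i.succ) := by
      rw [Equiv.Perm.mclosure_swap_castSucc_succ]; trivial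
    induction h using Submonoid.closure_induction with
    | mem x hx =>
      obtain ⟨i, rfl⟩ := hx
      exact ⟨[i], by simp [wordProd, simple]; rfl⟩
    | one => exact ⟨[], rfl⟩
    | mul x y _ _ hx hy =>
      obtain ⟨u, rfl⟩ := hx
      obtain ⟨v, rfl⟩ := hy
      exact ⟨u ++ v, by simp [wordProd]⟩

/-- Every permutation has a reduced decomposition. -/
theorem exists_isReducedWord {n : ℕ} (σ : Equiv.Perm (Fin n)) :
    ∃ u : List (Fin (n - 1)), IsReducedWord u σ := by
  obtain ⟨v, hv⟩ := exists_word σ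
  exact Nat.sInf_mem
    (s := {r | ∃ u : List (Fin (n - 1)), wordProd u = σ ∧ u.length = r}) ⟨_, v, hv, rfl⟩

/-- `τ` is a Bruhat transposition for `σ`: right multiplication of `σ` by the transposition `τ`
raises the length by exactly one, that is, `σ * τ` covers `σ` in the Bruhat order. -/
def IsBruhatTransposition {n : ℕ} (σ τ : Equiv.Perm (Fin n)) : Prop :=
  τ.IsSwap ∧ len (σ * τ) = len σ + 1

/-- The (strong) Bruhat order: the reflexive transitive closure of the covering relation. -/
def BruhatLE {n : ℕ} : Equiv.Perm (Fin n) → Equiv.Perm (Fin n) → Prop :=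
  Relation.ReflTransGen fun σ μ => ∃ τ, IsBruhatTransposition σ τ ∧ μ = σ * τ

/-- The maximal permutation `n (n-1) … 1`. -/
def omega (n : ℕ) : Equiv.Perm (Fin n) := Fin.revPerm

/-- The subgroup `S_{k₁} × S_{k₂-k₁} × ⋯ × S_{n-kₘ}` of `S_n`: the permutations that
preserve each of the blocks of positions cut out by `k₁ < ⋯ < kₘ`, equivalently each of the initial
segments `{1, …, kⱼ}`. -/
def parabolic {n m : ℕ} (k : Fin m → ℕ) : Subgroup (Equiv.Perm (Fin n)) where
  carrier := {g | ∀ (j : Fin m) (x : Fin n), (g x).val < k j ↔ x.val < k j}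
  one_mem' := fun _ _ => Iff.rfl
  mul_mem' := fun ha hb j x => (ha j _).trans (hb j x)
  inv_mem' := by
    intro g hg j x
    have h := hg j (g⁻¹ x)
    have e : g (g⁻¹ x) = x := g.apply_symm_apply x
    rw [e] at h
    exact h.symm

/-- `ζ` is the maximal element, for the Bruhat order, of the coset
`σ (S_{k₁} × S_{k₂-k₁} × ⋯ × S_{n-kₘ})`. -/
def IsCosetMax {n m : ℕ} (k : Fin m → ℕ) (σ ζ : Equiv.Perm (Fin n)) : Prop :=
  σ⁻¹ * ζ ∈ parabolic (n := n) k ∧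
    ∀ μ : Equiv.Perm (Fin n), σ⁻¹ * μ ∈ parabolic (n := n) k → BruhatLE μ ζ

/-- The free module on the basis `(K_σ)`, `σ ∈ S_n`. -/
abbrev KSpace (R : Type*) [CommRing R] (n : ℕ) : Type _ := Equiv.Perm (Fin n) →₀ R

/-- The basis vector `K_σ`. -/
noncomputable def K (R : Type*) [CommRing R] {n : ℕ} (σ : Equiv.Perm (Fin n)) : KSpace R n :=
  Finsupp.single σ 1

/-- The operator `π_i`: `K_σ π_i = K_{σ s_i}` if `σ_i > σ_{i+1}`, and `K_σ π_i = K_σ` otherwise. -/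
noncomputable def piOp (R : Type*) [CommRing R] {n : ℕ} (i : Fin (n - 1)) :
    KSpace R n →ₗ[R] KSpace R n :=
  Finsupp.linearCombination R fun σ : Equiv.Perm (Fin n) =>
    if σ ⟨i.val + 1, by omega⟩ < σ ⟨i.val, by omega⟩ then K R (σ * simple i) else K R σ

/-- The operator `π̂_i = π_i - 1`. -/
noncomputable def piHatOp (R : Type*) [CommRing R] {n : ℕ} (i : Fin (n - 1)) :
    KSpace R n →ₗ[R] KSpace R n :=
  piOp R i - LinearMap.id

/-- The right action `f π_{i₁} π_{i₂} ⋯ π_{iᵣ}` (the leftmost letter acts first). -/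
noncomputable def piWord {R : Type*} [CommRing R] {n : ℕ} (f : KSpace R n)
    (u : List (Fin (n - 1))) : KSpace R n :=
  u.foldl (fun g i => piOp R i g) f

/-- The right action `f π̂_{i₁} π̂_{i₂} ⋯ π̂_{iᵣ}` (the leftmost letter acts first). -/
noncomputable def piHatWord {R : Type*} [CommRing R] {n : ℕ} (f : KSpace R n)
    (u : List (Fin (n - 1))) : KSpace R n :=
  u.foldl (fun g i => piHatOp R i g) f

/-- The previous cut point, with the convention `k₀ = 0`. -/
def prevCut {m : ℕ} (k : Fin m → ℕ) (i : Fin m) : ℕ :=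
  if i.val = 0 then 0 else k ⟨i.val - 1, by omega⟩

/-- The list `𝒲_i`, where the pair `(a, b)` stands for the transposition of positions `a`, `b`:
`a` increases through `k_{i-1} + 1, …, k_i`, and for each `a`,
`b` decreases through `n, n - 1, …, k_i + 1` (1-indexed). -/
def blockList (n : ℕ) {m : ℕ} (k : Fin m → ℕ) (i : Fin m) : List (Fin n × Fin n) :=
  ((List.finRange n).filter fun a => prevCut k i ≤ a.val ∧ a.val < k i).flatMap fun a =>
    ((List.finRange n).reverse.filter fun b => k i ≤ b.val).map fun b => (a, b)

/-- The list `𝒲_{(k₁, …, kₘ)}`, the concatenation of `𝒲_m, 𝒲_{m-1}, …, 𝒲_1`. -/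
def transpList (n : ℕ) {m : ℕ} (k : Fin m → ℕ) : List (Fin n × Fin n) :=
  (List.finRange m).reverse.flatMap fun i => blockList n k i

/-- The permutation `σ w = σ τ₁ τ₂ ⋯ τᵣ` for a word `w = τ₁ τ₂ … τᵣ` on transpositions. -/
def mulWord {n : ℕ} (σ : Equiv.Perm (Fin n)) (w : List (Fin n × Fin n)) : Equiv.Perm (Fin n) :=
  σ * (w.map fun p => Equiv.swap p.1 p.2).prod

/-- The word `w = τ₁ … τᵣ` is a path in the Bruhat order starting from `σ`: each of
`σ, σ τ₁, σ τ₁ τ₂, …` is covered by the next one. -/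
def IsBruhatPath {n : ℕ} : Equiv.Perm (Fin n) → List (Fin n × Fin n) → Prop
  | _, [] => True
  | σ, p :: w => IsBruhatTransposition σ (Equiv.swap p.1 p.2) ∧
      IsBruhatPath (σ * Equiv.swap p.1 p.2) w

open Classical in
/-- The subwords of `𝒲_{(k₁, …, kₘ)}` that are paths in the Bruhat order starting from `σ`.
(The list has no repeated entry, so its subwords are determined by their letters.) -/
noncomputable def validSubwords {n m : ℕ} (k : Fin m → ℕ) (σ : Equiv.Perm (Fin n)) :
    Finset (List (Fin n × Fin n)) :=
  (transpList n k).sublists.toFinset.filter fun w => IsBruhatPath σ w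

/-- The sum `∑ (-1)^{|w|} K_{σ w}` over the valid subwords `w`. -/
noncomputable def chainSum (R : Type*) [CommRing R] {n m : ℕ} (k : Fin m → ℕ)
    (σ : Equiv.Perm (Fin n)) : KSpace R n :=
  ∑ w ∈ validSubwords k σ, ((-1 : R) ^ w.length) • K R (mulWord σ w)

/-- The set of permutations `σ w` indexing the sum. -/
def summationSet {n m : ℕ} (k : Fin m → ℕ) (σ : Equiv.Perm (Fin n)) :
    Set (Equiv.Perm (Fin n)) :=
  {ν | ∃ w ∈ validSubwords k σ, mulWord σ w = ν}

end ZeroHecke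

/-! Let `X a b` be the operator `K_σ ↦ K_σ - K_{σ (a b)}` if `σ (a b)` covers `σ`, and `K_σ ↦ K_σ`
otherwise. The operators `X a b` satisfy the Yang–Baxter equation
`X a b * X a c * X b c = X b c * X a c * X a b`, so the product `F` of all of them can be taken in
several orders. One order is `F = I * W`, where `W` runs through the list `𝒲` and `I` through the
transpositions inside the blocks; others are `F = X i (i + 1) * T` with `T` commuting with `π_i`,
whence `K_{σ s_i} F = K_σ F π̂_i` when `σ s_i` is shorter than `σ`, and so `K_ω π̂_{ω ζ} = K_ζ F`.
Since `ζ` decreases on blocks, `K_ζ I = K_ζ`; since `W` commutes with `π_i` for `s_i` in the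
parabolic subgroup, `K_ω π̂_{ω ζ} π_{ζ⁻¹ σ} = K_ζ W π_{ζ⁻¹ σ} = K_σ W`, which expands to the sum
over valid subwords.

The recursion on `F` also shows that `K_μ` has coefficient `±1` in `K_σ F` for all `μ ≥ σ`. As all
chains from `σ` to `μ` contribute with the same sign, every `μ ≥ σ` is reached from `σ` by exactly
one subword of the list of factors of `I * W`. This yields the absence of cancellation, and
characterizes the endpoints of the valid subwords as the `μ ≥ σ` such that every `γ ≤ μ` in the
coset of `σ` satisfies `γ ≤ σ`, a condition which is closed under intervals. -/

namespace ZeroHecke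

open Equiv

section Length

variable {n : ℕ}

/-- The number of inversions of a permutation, an explicit formula for its length `len`. -/
def invCount (σ : Perm (Fin n)) : ℕ :=
  (Finset.univ.filter fun p : Fin n × Fin n => p.1 < p.2 ∧ σ p.2 < σ p.1).card

theorem mul_swap_apply_of_ne (σ : Perm (Fin n)) {a b c : Fin n} (hca : c ≠ a) (hcb : c ≠ b) :
    (σ * swap a b) c = σ c := by
  rw [Perm.mul_apply, swap_apply_of_ne_of_ne hca hcb]

theorem swap_lt_swap_iff_of_adjacent {i j p q : Fin n} (hij : j.val = i.val + 1)
    (hpq : ¬(p = i ∧ q = j)) (hqp : ¬(p = j ∧ q = i)) : swap i j p < swap i j q ↔ p < q := by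
  simp only [swap_apply_def]
  split_ifs <;> omega

theorem invCount_mul_swap_of_adjacent {σ : Perm (Fin n)} {i j : Fin n} (hij : j.val = i.val + 1)
    (h : σ i < σ j) : invCount (σ * swap i j) = invCount σ + 1 := by
  have hlt : i < j := by rw [Fin.lt_def, hij]; exact Nat.lt_succ_self _
  set inversions := fun σ : Perm (Fin n) =>
    Finset.univ.filter fun p : Fin n × Fin n => p.1 < p.2 ∧ σ p.2 < σ p.1
  have mem_inversions (σ p q) : (p, q) ∈ inversions σ ↔ p < q ∧ σ q < σ p := by
    simp only [inversions, Finset.mem_filter, Finset.mem_univ, true_and]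
  let e := (Equiv.prodCongr (swap i j) (swap i j)).toEmbedding
  have mem_map (p q) : (p, q) ∈ (inversions σ).map e ↔
      (swap i j p, swap i j q) ∈ inversions σ := by
    simp only [e, Finset.mem_map_equiv, prodCongr_symm, symm_swap, prodCongr_apply, Prod.map_apply]
  have hnew : (i, j) ∉ (inversions σ).map e := by
    simp only [mem_map, mem_inversions, swap_apply_left, swap_apply_right]
    exact fun hji => hji.1.not_gt hlt
  have hins : inversions (σ * swap i j) = insert (i, j) ((inversions σ).map e) := by
    ext ⟨p, q⟩
    simp only [Finset.mem_insert, mem_map, mem_inversions, Perm.mul_apply, Prod.mk.injEq]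
    by_cases hpq : p = i ∧ q = j
    · simp [hpq, h, hlt]
    by_cases hqp : p = j ∧ q = i
    · simp [hqp, h.le, hlt.ne']
    · simp [hpq, swap_lt_swap_iff_of_adjacent hij hpq hqp]
  calc invCount (σ * swap i j) = (inversions (σ * swap i j)).card := rfl
    _ = invCount σ + 1 := by rw [hins, Finset.card_insert_of_notMem hnew, Finset.card_map]; rfl

theorem invCount_mul_swap_of_adjacent' {σ : Perm (Fin n)} {i j : Fin n}
    (hij : j.val = i.val + 1) (h : σ j < σ i) : invCount (σ * swap i j) + 1 = invCount σ := by
  rw [← invCount_mul_swap_of_adjacent (σ := σ * swap i j) hij (by simpa using h), mul_assoc,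
    swap_mul_self, mul_one]

theorem invCount_one : invCount (1 : Perm (Fin n)) = 0 := by
  rw [invCount, Finset.card_eq_zero, Finset.filter_eq_empty_iff]
  exact fun p _ hp => hp.1.not_gt hp.2

/-- The left one of the two positions exchanged by `simple i`. -/
abbrev leftPos (i : Fin (n - 1)) : Fin n := ⟨i.val, by omega⟩

/-- The right one of the two positions exchanged by `simple i`. -/
abbrev rightPos (i : Fin (n - 1)) : Fin n := ⟨i.val + 1, by omega⟩

theorem simple_eq_swap (i : Fin (n - 1)) : simple i = swap (leftPos i) (rightPos i) := rfl

@[simp] theorem simple_mul_self (i : Fin (n - 1)) : simple i * simple i = 1 := swap_mul_self _ _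

@[simp] theorem mul_simple_mul_simple (σ : Perm (Fin n)) (i : Fin (n - 1)) :
    σ * simple i * simple i = σ := by rw [mul_assoc, simple_mul_self, mul_one]

@[simp] theorem simple_leftPos (i : Fin (n - 1)) : simple i (leftPos i) = rightPos i :=
  swap_apply_left _ _

@[simp] theorem simple_rightPos (i : Fin (n - 1)) : simple i (rightPos i) = leftPos i :=
  swap_apply_right _ _

theorem leftPos_lt_rightPos (i : Fin (n - 1)) : leftPos i < rightPos i := by simp [Fin.lt_def]

theorem apply_leftPos_ne (σ : Perm (Fin n)) (i : Fin (n - 1)) : σ (leftPos i) ≠ σ (rightPos i) :=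
  σ.injective.ne (leftPos_lt_rightPos i).ne

theorem invCount_mul_simple {σ : Perm (Fin n)} {i : Fin (n - 1)}
    (h : σ (leftPos i) < σ (rightPos i)) : invCount (σ * simple i) = invCount σ + 1 :=
  invCount_mul_swap_of_adjacent rfl h

theorem invCount_mul_simple' {σ : Perm (Fin n)} {i : Fin (n - 1)}
    (h : σ (rightPos i) < σ (leftPos i)) : invCount (σ * simple i) + 1 = invCount σ :=
  invCount_mul_swap_of_adjacent' rfl h

theorem invCount_mul_simple_le (σ : Perm (Fin n)) (i : Fin (n - 1)) :
    invCount (σ * simple i) ≤ invCount σ + 1 := by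
  rcases lt_or_gt_of_ne (apply_leftPos_ne σ i) with hasc | hdesc
  · exact (invCount_mul_simple hasc).le
  · have := invCount_mul_simple' hdesc; omega

theorem wordProd_concat (u : List (Fin (n - 1))) (i : Fin (n - 1)) :
    wordProd (u ++ [i]) = wordProd u * simple i := by simp [wordProd]

theorem invCount_wordProd_le (u : List (Fin (n - 1))) : invCount (wordProd u) ≤ u.length := by
  induction u using List.reverseRecOn with
  | nil => exact invCount_one.le
  | append_singleton u i ih =>
    rw [wordProd_concat, List.length_append, List.length_singleton]
    exact (invCount_mul_simple_le _ _).trans (by omega)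

theorem strictMonoOn_of_forall_lt {σ : Perm (Fin n)} {s : Set (Fin n)} (hs : s.OrdConnected)
    (h : ∀ i, leftPos i ∈ s → rightPos i ∈ s → σ (leftPos i) < σ (rightPos i)) :
    StrictMonoOn σ s := by
  refine strictMonoOn_of_lt_succ hs fun a hmax ha hsucc => ?_
  have hlt : a < Order.succ a := Order.lt_succ_of_not_isMax hmax
  have hle : Order.succ a ≤ ⟨a.val + 1, by omega⟩ := Order.succ_le_of_lt (by simp [Fin.lt_def])
  have heq : Order.succ a = rightPos ⟨a.val, by omega⟩ := le_antisymm hle (Nat.succ_le_of_lt hlt)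
  rw [heq] at hsucc ⊢
  exact h ⟨a.val, by omega⟩ ha hsucc

theorem exists_descent {σ : Perm (Fin n)} (h : σ ≠ 1) :
    ∃ i : Fin (n - 1), σ (rightPos i) < σ (leftPos i) := by
  by_contra! hc
  have hmono : StrictMonoOn σ Set.univ :=
    strictMonoOn_of_forall_lt Set.ordConnected_univ
      fun i _ _ => (hc i).lt_of_ne (apply_leftPos_ne σ i)
  exact h (σ.monotone_iff.1 (strictMonoOn_univ.1 hmono).monotone)

theorem exists_word_length_eq_invCount (σ : Perm (Fin n)) :
    ∃ u : List (Fin (n - 1)), wordProd u = σ ∧ u.length = invCount σ := by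
  induction hr : invCount σ generalizing σ with
  | zero =>
    by_cases h : σ = 1
    · exact ⟨[], h ▸ rfl, rfl⟩
    · obtain ⟨i, hi⟩ := exists_descent h
      have := invCount_mul_simple' hi
      omega
  | succ r ih =>
    have h : σ ≠ 1 := by rintro rfl; simp [invCount_one] at hr
    obtain ⟨i, hi⟩ := exists_descent h
    have := invCount_mul_simple' hi
    obtain ⟨u, hu, hlen⟩ := ih (σ * simple i) (by omega)
    exact ⟨u ++ [i], by rw [wordProd_concat, hu, mul_simple_mul_simple], by simp [hlen]⟩

theorem len_eq_invCount (σ : Perm (Fin n)) : len σ = invCount σ := by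
  apply le_antisymm
  · exact Nat.sInf_le (exists_word_length_eq_invCount σ)
  · obtain ⟨u, rfl, hlen⟩ := exists_isReducedWord σ
    exact (invCount_wordProd_le u).trans hlen.le

end Length

section Cover

variable {n : ℕ} {σ μ ν : Perm (Fin n)} {a b c : Fin n} {i : Fin (n - 1)}

/-- The one-line notation of the covering relation: `σ * swap a b` covers `σ` in the Bruhat order,
where `a < b`. -/
def Cov (σ : Perm (Fin n)) (a b : Fin n) : Prop :=
  a < b ∧ σ a < σ b ∧ ∀ c, a < c → c < b → ¬(σ a < σ c ∧ σ c < σ b)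

instance (σ : Perm (Fin n)) (a b : Fin n) : Decidable (Cov σ a b) := by
  unfold Cov; infer_instance

theorem swap_eq_swap_mul_swap_mul_swap (hac : a < c) (hcb : c < b) :
    swap a b = swap c b * swap a c * swap c b := by
  rw [swap_mul_swap_mul_swap hac.ne (hac.trans hcb).ne, swap_comm]

theorem Cov.invCount_eq (h : Cov σ a b) : invCount (σ * swap a b) = invCount σ + 1 := by
  obtain ⟨hab, hval, hmid⟩ := h
  induction hd : b.val - a.val using Nat.strong_induction_on generalizing σ b with
  | _ d ih =>
    by_cases hadj : b.val = a.val + 1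
    · exact invCount_mul_swap_of_adjacent hadj hval
    obtain ⟨c, hcb⟩ : ∃ c : Fin n, b.val = c.val + 1 := ⟨⟨b.val - 1, by omega⟩, by simp; omega⟩
    have hac : a < c := by omega
    have hcb' : c < b := by omega
    have ha : (σ * swap c b) a = σ a := mul_swap_apply_of_ne σ hac.ne hab.ne
    have hc : (σ * swap c b) c = σ b := by simp
    have ih : invCount (σ * swap c b * swap a c) = invCount (σ * swap c b) + 1 := by
      refine ih _ (by omega) hac (by rwa [ha, hc]) (fun p hap hpc => ?_) rfl
      rw [ha, hc, mul_swap_apply_of_ne σ hpc.ne (hpc.trans hcb').ne]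
      exact hmid p hap (hpc.trans hcb')
    have hc' : (σ * swap c b * swap a c) c = σ a := by rw [Perm.mul_apply, swap_apply_right, ha]
    have hb' : (σ * swap c b * swap a c) b = σ c := by
      rw [mul_swap_apply_of_ne _ hab.ne' hcb'.ne', Perm.mul_apply, swap_apply_right]
    rw [swap_eq_swap_mul_swap_mul_swap hac hcb', ← mul_assoc, ← mul_assoc]
    rcases lt_or_gt_of_ne (σ.injective.ne hac.ne) with hlow | hhigh
    · have hbc : σ b < σ c :=
        (not_lt.1 fun h => hmid c hac hcb' ⟨hlow, h⟩).lt_of_ne (σ.injective.ne hcb'.ne')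
      have hdown := invCount_mul_swap_of_adjacent' hcb hbc
      have hup := invCount_mul_swap_of_adjacent (σ := σ * swap c b * swap a c) hcb
        (by rwa [hc', hb'])
      omega
    · have hup := invCount_mul_swap_of_adjacent hcb (hhigh.trans hval)
      have hdown := invCount_mul_swap_of_adjacent' (σ := σ * swap c b * swap a c) hcb
        (by rwa [hc', hb'])
      omega

theorem cov_or_invCount_add_two_le (hab : a < b) (hval : σ a < σ b) :
    Cov σ a b ∨ invCount σ + 2 ≤ invCount (σ * swap a b) := by
  induction hd : b.val - a.val using Nat.strong_induction_on generalizing σ a b with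
  | _ d ih =>
    refine or_iff_not_imp_left.2 fun hcov => ?_
    obtain ⟨c, hac, hcb, hlow, hhigh⟩ : ∃ c, a < c ∧ c < b ∧ σ a < σ c ∧ σ c < σ b := by
      simpa [Cov, hab, hval] using hcov
    have increases {τ : Perm (Fin n)} {p q : Fin n} (hpq : p < q) (hτ : τ p < τ q)
        (hlt : q.val - p.val < d) : invCount τ < invCount (τ * swap p q) := by
      rcases ih _ hlt hpq hτ rfl with h | h
      · have := h.invCount_eq
        omega
      · omega
    have eq_b : (σ * swap a c) b = σ b := mul_swap_apply_of_ne σ hab.ne' hcb.ne'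
    have eq_a : (σ * swap a c * swap c b) a = σ c := by
      rw [mul_swap_apply_of_ne _ hac.ne hab.ne, Perm.mul_apply, swap_apply_left]
    have eq_c : (σ * swap a c * swap c b) c = σ b := by
      rw [Perm.mul_apply, swap_apply_left, eq_b]
    have first : invCount σ < invCount (σ * swap a c) := increases hac hlow (by omega)
    have second : invCount (σ * swap a c) < invCount (σ * swap a c * swap c b) :=
      increases hcb (by simpa [eq_b] using hlow.trans hhigh) (by omega)
    have third :
        invCount (σ * swap a c * swap c b) < invCount (σ * swap a c * swap c b * swap a c) :=
      increases hac (by rwa [eq_a, eq_c]) (by omega)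
    have hswap : swap a b = swap a c * swap c b * swap a c := by
      rw [swap_comm c b, swap_comm a c, swap_mul_swap_mul_swap hcb.ne' hab.ne']
    rw [hswap, ← mul_assoc, ← mul_assoc]
    omega

theorem isBruhatTransposition_swap_iff_cov (hab : a < b) :
    IsBruhatTransposition σ (swap a b) ↔ Cov σ a b := by
  rw [IsBruhatTransposition, len_eq_invCount, len_eq_invCount]
  refine ⟨fun ⟨_, hlen⟩ => ?_, fun h => ⟨⟨a, b, hab.ne, rfl⟩, h.invCount_eq⟩⟩
  rcases lt_or_gt_of_ne (σ.injective.ne hab.ne) with hasc | hdesc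
  · exact (cov_or_invCount_add_two_le hab hasc).resolve_right (by omega)
  · have := cov_or_invCount_add_two_le (σ := σ * swap a b) hab (by simpa using hdesc)
    rw [mul_assoc, swap_mul_self, mul_one] at this
    rcases this with hcov | hle
    · have := hcov.invCount_eq
      rw [mul_assoc, swap_mul_self, mul_one] at this
      omega
    · omega

theorem isBruhatTransposition_swap_iff :
    IsBruhatTransposition σ (swap a b) ↔ Cov σ a b ∨ Cov σ b a := by
  rcases lt_trichotomy a b with hab | rfl | hab
  · rw [isBruhatTransposition_swap_iff_cov hab]
    exact ⟨Or.inl, fun h => h.resolve_right fun hba => hab.not_gt hba.1⟩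
  · simp [IsBruhatTransposition, Cov, ← Perm.one_def]
  · rw [swap_comm, isBruhatTransposition_swap_iff_cov hab]
    exact ⟨Or.inr, fun h => h.resolve_left fun hba => hab.not_gt hba.1⟩

theorem exists_isBruhatTransposition_iff :
    (∃ τ, IsBruhatTransposition σ τ ∧ μ = σ * τ) ↔ ∃ a b, Cov σ a b ∧ μ = σ * swap a b := by
  constructor
  · rintro ⟨τ, h, rfl⟩
    obtain ⟨a, b, -, rfl⟩ := h.1
    rcases isBruhatTransposition_swap_iff.1 h with hcov | hcov
    · exact ⟨a, b, hcov, rfl⟩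
    · exact ⟨b, a, hcov, by rw [swap_comm]⟩
  · rintro ⟨a, b, h, rfl⟩
    exact ⟨swap a b, (isBruhatTransposition_swap_iff_cov h.1).2 h, rfl⟩

theorem cov_leftPos_rightPos_iff :
    Cov σ (leftPos i) (rightPos i) ↔ σ (leftPos i) < σ (rightPos i) := by
  refine ⟨fun h => h.2.1, fun h => ⟨leftPos_lt_rightPos i, h, fun c hlt hgt => ?_⟩⟩
  simp only [Fin.lt_def] at hlt hgt
  omega

theorem bruhatLE_refl (σ : Perm (Fin n)) : BruhatLE σ σ := Relation.ReflTransGen.refl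

theorem BruhatLE.trans (h : BruhatLE σ μ) (h' : BruhatLE μ ν) : BruhatLE σ ν :=
  Relation.ReflTransGen.trans h h'

theorem Cov.bruhatLE (h : Cov σ a b) : BruhatLE σ (σ * swap a b) :=
  Relation.ReflTransGen.single (exists_isBruhatTransposition_iff.2 ⟨a, b, h, rfl⟩)

theorem bruhatLE_mul_simple (h : σ (leftPos i) < σ (rightPos i)) : BruhatLE σ (σ * simple i) :=
  (cov_leftPos_rightPos_iff.2 h).bruhatLE

theorem BruhatLE.cov_induction {P : Perm (Fin n) → Prop} (h : BruhatLE σ ν) (refl : P σ)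
    (step : ∀ μ a b, BruhatLE σ μ → Cov μ a b → P μ → P (μ * swap a b)) : P ν := by
  induction h with
  | refl => exact refl
  | tail hle hcover ih =>
    obtain ⟨a, b, hcov, rfl⟩ := exists_isBruhatTransposition_iff.1 hcover
    exact step _ _ _ hle hcov ih

theorem BruhatLE.eq_or_invCount_lt (h : BruhatLE σ μ) : σ = μ ∨ invCount σ < invCount μ := by
  refine h.cov_induction (P := fun μ => σ = μ ∨ invCount σ < invCount μ) (Or.inl rfl) ?_
  rintro μ a b - hcov (rfl | hlt) <;> right <;> rw [hcov.invCount_eq] <;> omega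

theorem BruhatLE.invCount_le (h : BruhatLE σ μ) : invCount σ ≤ invCount μ := by
  rcases h.eq_or_invCount_lt with rfl | hlt
  · exact le_rfl
  · exact hlt.le

theorem BruhatLE.antisymm (h : BruhatLE σ μ) (h' : BruhatLE μ σ) : σ = μ :=
  h.eq_or_invCount_lt.resolve_right h'.invCount_le.not_gt

end Cover

section Cover

variable {n : ℕ} {σ : Perm (Fin n)} {a b c d : Fin n} {i : Fin (n - 1)}

theorem mul_swap_apply (σ : Perm (Fin n)) (a b p : Fin n) :
    (σ * swap a b) p = if p = a then σ b else if p = b then σ a else σ p := by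
  rw [Perm.mul_apply, swap_apply_def]
  split_ifs <;> rfl

theorem mul_swap_mul_swap_comm (σ : Perm (Fin n)) (hac : a ≠ c) (had : a ≠ d) (hbc : b ≠ c)
    (hbd : b ≠ d) : σ * swap a b * swap c d = σ * swap c d * swap a b := by
  ext p
  simp only [mul_swap_apply]
  grind

theorem Cov.cov_and_cov_of_disjoint (hac : a ≠ c) (had : a ≠ d) (hbc : b ≠ c) (hbd : b ≠ d)
    (h : Cov σ a b) (h' : Cov (σ * swap a b) c d) : Cov σ c d ∧ Cov (σ * swap c d) a b := by
  have hinj := σ.injective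
  revert h h'
  simp only [Cov, mul_swap_apply]
  grind (splits := 25)

theorem cov_and_cov_comm (hac : a ≠ c) (had : a ≠ d) (hbc : b ≠ c) (hbd : b ≠ d) :
    Cov σ a b ∧ Cov (σ * swap a b) c d ↔ Cov σ c d ∧ Cov (σ * swap c d) a b :=
  ⟨fun h => h.1.cov_and_cov_of_disjoint hac had hbc hbd h.2,
    fun h => h.1.cov_and_cov_of_disjoint hac.symm hbc.symm had.symm hbd.symm h.2⟩

theorem cov_left_right_iff_or (hab : a < b) (hbc : b < c) :
    Cov σ a b ∧ Cov (σ * swap a b) b c ↔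
      (Cov σ b c ∧ Cov (σ * swap b c) a c) ∨ (Cov σ a c ∧ Cov (σ * swap a c) a b) := by
  have hinj := σ.injective
  simp only [Cov, mul_swap_apply]
  rcases lt_or_gt_of_ne (σ.injective.ne hbc.ne) with h | h <;> constructor <;> grind

theorem cov_mul_simple_iff (hal : a ≠ leftPos i) (har : a ≠ rightPos i) (hbl : b ≠ leftPos i)
    (hbr : b ≠ rightPos i) : Cov (σ * simple i) a b ↔ Cov σ a b := by
  have hlr : (rightPos i).val = (leftPos i).val + 1 := rfl
  rw [simple_eq_swap]
  generalize leftPos i = l, rightPos i = r at *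
  have forward {σ : Perm (Fin n)} (h : Cov σ a b) : Cov (σ * swap l r) a b := by
    revert h
    simp only [Cov, mul_swap_apply]
    grind
  exact ⟨fun h => by simpa [mul_assoc] using forward h, forward⟩

theorem omega_apply (p : Fin n) : omega n p = p.rev := rfl

theorem cov_omega_conj_iff : Cov (omega n * σ * omega n) b.rev a.rev ↔ Cov σ a b := by
  simp only [Cov, Perm.mul_apply, omega_apply, Fin.rev_rev, Fin.rev_lt_rev]
  refine and_congr_right fun _ => and_congr_right fun _ => ?_
  constructor
  · intro h c hac hcb hval
    exact h c.rev (Fin.rev_lt_rev.2 hcb) (Fin.rev_lt_rev.2 hac)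
      (by simpa only [Fin.rev_rev, Fin.rev_lt_rev] using hval.symm)
  · intro h c hbc hca hval
    exact h c.rev (Fin.lt_rev_iff.1 hca) (Fin.rev_lt_iff.1 hbc) hval.symm

end Cover

section Operators

variable {R : Type*} [CommRing R] {n : ℕ} {a b c d : Fin n} {i : Fin (n - 1)}

variable (R n) in
/-- The algebra of operators acting on the right of the free module on the `K_σ`: in a product,
the left factor acts first. -/
def RightOp : Type _ := (Module.End R (KSpace R n))ᵐᵒᵖ

noncomputable instance : Ring (RightOp R n) :=
  inferInstanceAs (Ring (Module.End R (KSpace R n))ᵐᵒᵖ)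

/-- The image of a vector under an operator acting on the right. -/
noncomputable def act (f : KSpace R n) (m : RightOp R n) : KSpace R n := m.unop f

@[simp] theorem act_one (f : KSpace R n) : act f 1 = f := rfl

@[simp] theorem act_mul (f : KSpace R n) (m m' : RightOp R n) :
    act f (m * m') = act (act f m) m' := rfl

@[simp] theorem act_op_add (f : KSpace R n) (m m' : RightOp R n) :
    act f (m + m') = act f m + act f m' := rfl

@[simp] theorem act_op_sub (f : KSpace R n) (m m' : RightOp R n) :
    act f (m - m') = act f m - act f m' := rfl

@[simp] theorem act_add (f g : KSpace R n) (m : RightOp R n) :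
    act (f + g) m = act f m + act g m := map_add m.unop f g

@[simp] theorem act_sub (f g : KSpace R n) (m : RightOp R n) :
    act (f - g) m = act f m - act g m := map_sub m.unop f g

@[simp] theorem act_zero (m : RightOp R n) : act 0 m = 0 := map_zero m.unop

theorem act_ite (p : Prop) [Decidable p] (f g : KSpace R n) (m : RightOp R n) :
    act (if p then f else g) m = if p then act f m else act g m := by split_ifs <;> rfl

theorem rightOp_ext {m m' : RightOp R n} (h : ∀ σ, act (K R σ) m = act (K R σ) m') : m = m' :=
  MulOpposite.unop_injective (Finsupp.lhom_ext' fun σ => LinearMap.ext_ring (h σ))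

variable (R) in
/-- The operator defined by its values on the basis `K_σ`. -/
noncomputable def basisOp (f : Perm (Fin n) → KSpace R n) : RightOp R n :=
  MulOpposite.op (Finsupp.linearCombination R f)

theorem act_basisOp (f : Perm (Fin n) → KSpace R n) (σ : Perm (Fin n)) :
    act (K R σ) (basisOp R f) = f σ :=
  (Finsupp.linearCombination_single R 1 σ).trans (one_smul R _)

variable (R) in
/-- The operator `K_σ ↦ K_{σ (a b)}` if `σ (a b)` covers `σ`, and `K_σ ↦ 0` otherwise. -/
noncomputable def coverOp (a b : Fin n) : RightOp R n :=
  basisOp R fun σ => if Cov σ a b then K R (σ * swap a b) else 0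

theorem act_coverOp (σ : Perm (Fin n)) (a b : Fin n) :
    act (K R σ) (coverOp R a b) = if Cov σ a b then K R (σ * swap a b) else 0 :=
  act_basisOp _ σ

theorem act_coverOp_mul_coverOp (σ : Perm (Fin n)) (a b c d : Fin n) :
    act (K R σ) (coverOp R a b * coverOp R c d) =
      if Cov σ a b ∧ Cov (σ * swap a b) c d then K R (σ * swap a b * swap c d) else 0 := by
  rw [act_mul, act_coverOp, act_ite, act_zero, act_coverOp, ite_and]

theorem coverOp_commute (hac : a ≠ c) (had : a ≠ d) (hbc : b ≠ c) (hbd : b ≠ d) :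
    Commute (coverOp R a b) (coverOp R c d) := by
  refine rightOp_ext fun σ => ?_
  rw [act_coverOp_mul_coverOp, act_coverOp_mul_coverOp,
    mul_swap_mul_swap_comm σ hac had hbc hbd]
  simp only [cov_and_cov_comm hac had hbc hbd]

theorem coverOp_mul_self (a b : Fin n) : coverOp R a b * coverOp R a b = 0 := by
  refine rightOp_ext fun σ => ?_
  rw [act_coverOp_mul_coverOp, if_neg]
  · rfl
  · rintro ⟨h, h'⟩
    exact h.2.1.not_gt (by simpa using h'.2.1)

/-- One of the quadratic relations of Fomin and Kirillov. -/
theorem coverOp_mul_add_mul_eq_left_mul_right (hab : a < b) (hbc : b < c) :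
    coverOp R b c * coverOp R a c + coverOp R a c * coverOp R a b =
      coverOp R a b * coverOp R b c := by
  refine rightOp_ext fun σ => ?_
  have hac := hab.trans hbc
  have heq : σ * swap b c * swap a c = σ * swap a b * swap b c := by
    ext p; simp only [mul_swap_apply]; grind
  have heq' : σ * swap a c * swap a b = σ * swap a b * swap b c := by
    ext p; simp only [mul_swap_apply]; grind
  have hor := cov_left_right_iff_or (σ := σ) hab hbc
  have hexcl (hq : Cov σ b c ∧ Cov (σ * swap b c) a c) :
      ¬(Cov σ a c ∧ Cov (σ * swap a c) a b) := fun hr =>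
    hq.1.2.1.not_gt (by simpa [swap_apply_of_ne_of_ne hab.ne' hbc.ne] using hr.2.2.1)
  simp only [act_op_add, act_coverOp_mul_coverOp, heq, heq']
  rw [if_congr hor rfl rfl]
  by_cases hq : Cov σ b c ∧ Cov (σ * swap b c) a c
  · rw [if_pos hq, if_neg (hexcl hq), if_pos (Or.inl hq), add_zero]
  · rw [if_neg hq, zero_add]
    exact if_congr (or_iff_right hq).symm rfl rfl

variable (R n) in
/-- The involution `K_σ ↦ K_{ω σ ω}`, which exchanges the two ends of the set of positions. -/
noncomputable def reversal : RightOp R n := basisOp R fun σ => K R (omega n * σ * omega n)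

theorem act_reversal (σ : Perm (Fin n)) :
    act (K R σ) (reversal R n) = K R (omega n * σ * omega n) := act_basisOp _ σ

@[simp] theorem omega_mul_self : omega n * omega n = 1 := by ext; simp [omega]

theorem omega_mul_omega_mul (σ : Perm (Fin n)) : omega n * (omega n * σ) = σ := by
  rw [← mul_assoc, omega_mul_self, one_mul]

theorem reversal_mul_self : reversal R n * reversal R n = 1 := by
  refine rightOp_ext fun σ => ?_
  rw [act_mul, act_reversal, act_reversal, act_one]
  congr 1
  ext; simp [omega]

theorem eq_of_semiconjBy_reversal {x x' y y' : RightOp R n} (hx : SemiconjBy (reversal R n) x' x)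
    (hy : SemiconjBy (reversal R n) y' y) (h : x' = y') : x = y := by
  have hxy : x * reversal R n = y * reversal R n := by rw [← hx.eq, ← hy.eq, h]
  simpa [mul_assoc, reversal_mul_self] using congrArg (· * reversal R n) hxy

theorem omega_conj_mul_swap (σ : Perm (Fin n)) (a b : Fin n) :
    omega n * (σ * swap a b) * omega n = omega n * σ * omega n * swap b.rev a.rev := by
  have hswap : swap b.rev a.rev = omega n * swap a b * omega n := by
    rw [swap_comm]
    exact swap_apply_apply (omega n) a b
  rw [hswap]
  simp only [mul_assoc, omega_mul_omega_mul]

theorem reversal_semiconjBy_coverOp (a b : Fin n) :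
    SemiconjBy (reversal R n) (coverOp R b.rev a.rev) (coverOp R a b) := by
  refine rightOp_ext fun σ => ?_
  rw [act_mul, act_mul, act_reversal, act_coverOp, act_coverOp, act_ite, act_zero, act_reversal,
    omega_conj_mul_swap]
  exact if_congr cov_omega_conj_iff rfl rfl

theorem coverOp_mul_add_mul_eq_right_mul_left (hab : a < b) (hbc : b < c) :
    coverOp R a b * coverOp R a c + coverOp R a c * coverOp R b c =
      coverOp R b c * coverOp R a b := by
  have hrev := reversal_semiconjBy_coverOp (R := R) (n := n)
  exact eq_of_semiconjBy_reversal
    (((hrev a b).mul_right (hrev a c)).add_right ((hrev a c).mul_right (hrev b c)))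
    ((hrev b c).mul_right (hrev a b))
    (coverOp_mul_add_mul_eq_left_mul_right (Fin.rev_lt_rev.2 hbc) (Fin.rev_lt_rev.2 hab))

variable (R) in
/-- The operator `K_σ ↦ K_σ - K_{σ (a b)}` if `σ (a b)` covers `σ`, and `K_σ ↦ K_σ` otherwise. -/
noncomputable def chainFactor (a b : Fin n) : RightOp R n := 1 - coverOp R a b

theorem act_chainFactor (σ : Perm (Fin n)) (a b : Fin n) :
    act (K R σ) (chainFactor R a b) = K R σ - if Cov σ a b then K R (σ * swap a b) else 0 := by
  rw [chainFactor, act_op_sub, act_one, act_coverOp]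

theorem chainFactor_commute (hac : a ≠ c) (had : a ≠ d) (hbc : b ≠ c) (hbd : b ≠ d) :
    Commute (chainFactor R a b) (chainFactor R c d) :=
  (Commute.one_left _).sub_left
    ((Commute.one_right _).sub_right (coverOp_commute hac had hbc hbd))

theorem one_sub_mul_one_sub_mul_one_sub_comm {A : Type*} [Ring A] {t u v : A} (hu : u * u = 0)
    (hut : u * v + v * t = t * u) (htu : t * v + v * u = u * t) :
    (1 - u) * (1 - v) * (1 - t) = (1 - t) * (1 - v) * (1 - u) := by
  have hcubic : u * v * t = t * v * u := calc
    u * v * t = u * (u * v + v * t) := by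
      rw [mul_add, ← mul_assoc, hu, zero_mul, zero_add, mul_assoc]
    _ = u * t * u := by rw [hut, mul_assoc]
    _ = (t * v + v * u) * u := by rw [htu]
    _ = t * v * u := by rw [add_mul, mul_assoc v, hu, mul_zero, add_zero]
  have hexpand (x y z : A) : (1 - x) * (1 - y) * (1 - z) =
      1 - x - y - z + (x * y + y * z) + x * z - x * y * z := by noncomm_ring
  rw [hexpand, hexpand, hcubic, hut, htu]
  abel

theorem chainFactor_yang_baxter (hab : a < b) (hbc : b < c) :
    chainFactor R b c * chainFactor R a c * chainFactor R a b =
      chainFactor R a b * chainFactor R a c * chainFactor R b c :=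
  one_sub_mul_one_sub_mul_one_sub_comm (coverOp_mul_self b c)
    (coverOp_mul_add_mul_eq_left_mul_right hab hbc)
    (coverOp_mul_add_mul_eq_right_mul_left hab hbc)

end Operators

section Commutation

variable {R : Type*} [CommRing R] {n : ℕ} {σ : Perm (Fin n)} {a b c : Fin n} {i : Fin (n - 1)}

variable (R) in
/-- The operator `π_i`, as an element of the algebra of operators acting on the right. -/
noncomputable def rightPi (i : Fin (n - 1)) : RightOp R n := MulOpposite.op (piOp R i)

theorem act_rightPi (σ : Perm (Fin n)) (i : Fin (n - 1)) :
    act (K R σ) (rightPi R i) =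
      if σ (rightPos i) < σ (leftPos i) then K R (σ * simple i) else K R σ :=
  act_basisOp _ σ

theorem act_rightPi_of_lt (h : σ (leftPos i) < σ (rightPos i)) :
    act (K R σ) (rightPi R i) = K R σ := by
  rw [act_rightPi, if_neg h.not_gt]

theorem act_rightPi_mul_simple (σ : Perm (Fin n)) (i : Fin (n - 1)) :
    act (K R (σ * simple i)) (rightPi R i) = act (K R σ) (rightPi R i) := by
  rw [act_rightPi, act_rightPi, Perm.mul_apply, Perm.mul_apply, simple_leftPos, simple_rightPos,
    mul_simple_mul_simple]
  rcases lt_or_gt_of_ne (apply_leftPos_ne σ i) with h | h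
  · rw [if_pos h, if_neg h.not_gt]
  · rw [if_neg h.not_gt, if_pos h]

theorem act_rightPi_mul_simple_of_lt (h : σ (leftPos i) < σ (rightPos i)) :
    act (K R (σ * simple i)) (rightPi R i) = K R σ := by
  rw [act_rightPi_mul_simple, act_rightPi_of_lt h]

theorem rightPi_commute_of_forall_lt {m : RightOp R n}
    (h : ∀ σ : Perm (Fin n), σ (leftPos i) < σ (rightPos i) →
      act (act (K R σ) m) (rightPi R i) = act (K R σ) m ∧
        act (act (K R (σ * simple i)) m) (rightPi R i) = act (K R σ) m) :
    Commute (rightPi R i) m := by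
  refine rightOp_ext fun σ => ?_
  rw [act_mul, act_mul]
  rcases lt_or_gt_of_ne (apply_leftPos_ne σ i) with hasc | hdesc
  · rw [act_rightPi_of_lt hasc, (h σ hasc).1]
  · have := (h (σ * simple i) (by simpa using hdesc)).2
    rw [mul_simple_mul_simple] at this
    rw [act_rightPi, if_pos hdesc, this]

theorem rightPi_commute_chainFactor (hal : a ≠ leftPos i) (har : a ≠ rightPos i)
    (hbl : b ≠ leftPos i) (hbr : b ≠ rightPos i) :
    Commute (rightPi R i) (chainFactor R a b) := by
  refine (Commute.one_right _).sub_right (rightPi_commute_of_forall_lt fun σ hasc => ?_)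
  have hasc' : (σ * swap a b) (leftPos i) < (σ * swap a b) (rightPos i) := by
    rwa [mul_swap_apply_of_ne σ hal.symm hbl.symm, mul_swap_apply_of_ne σ har.symm hbr.symm]
  have hcomm : σ * simple i * swap a b = σ * swap a b * simple i :=
    mul_swap_mul_swap_comm σ hal.symm hbl.symm har.symm hbr.symm
  rw [act_coverOp, act_coverOp, if_congr (cov_mul_simple_iff hal har hbl hbr) rfl rfl, hcomm,
    act_ite, act_ite, act_zero, act_rightPi_of_lt hasc', act_rightPi_mul_simple_of_lt hasc']
  exact ⟨rfl, rfl⟩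

theorem Cov.apply_lt_apply_rightPos (h : Cov σ (leftPos i) c) (hc : rightPos i < c)
    (hasc : σ (leftPos i) < σ (rightPos i)) : σ c < σ (rightPos i) :=
  (not_lt.1 fun hlt => h.2.2 _ (leftPos_lt_rightPos i) hc ⟨hasc, hlt⟩).lt_of_ne
    (σ.injective.ne hc.ne')

theorem cov_mul_simple_left_iff (hc : rightPos i < c) (hasc : σ (leftPos i) < σ (rightPos i)) :
    Cov (σ * simple i) (leftPos i) c ↔ Cov σ (rightPos i) c := by
  have hlr : (rightPos i).val = (leftPos i).val + 1 := rfl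
  rw [simple_eq_swap]
  generalize leftPos i = l, rightPos i = r at *
  simp only [Cov, mul_swap_apply]
  grind

theorem cov_mul_simple_right_iff (hc : rightPos i < c) (hasc : σ (leftPos i) < σ (rightPos i)) :
    Cov (σ * simple i) (rightPos i) c ↔ Cov σ (leftPos i) c ∨
      (Cov (σ * simple i) (leftPos i) c ∧
        Cov (σ * simple i * swap (leftPos i) c) (rightPos i) c) := by
  have hlr : (rightPos i).val = (leftPos i).val + 1 := rfl
  have hinj := σ.injective
  rw [simple_eq_swap]
  generalize leftPos i = l, rightPos i = r at *
  simp only [Cov, mul_swap_apply]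
  rcases lt_or_gt_of_ne (σ.injective.ne hc.ne) with h | h <;> constructor <;> grind

theorem mul_simple_mul_swap_left (hc : rightPos i < c) :
    σ * simple i * swap (leftPos i) c = σ * swap (rightPos i) c * simple i := by
  have := leftPos_lt_rightPos i
  rw [simple_eq_swap]
  ext p
  simp only [mul_swap_apply]
  grind

theorem mul_simple_mul_swap_right (hc : rightPos i < c) :
    σ * simple i * swap (rightPos i) c = σ * swap (leftPos i) c * simple i := by
  have := leftPos_lt_rightPos i
  rw [simple_eq_swap]
  ext p
  simp only [mul_swap_apply]
  grind

theorem mul_simple_mul_swap_mul_swap (hc : rightPos i < c) :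
    σ * simple i * swap (leftPos i) c * swap (rightPos i) c = σ * swap (leftPos i) c := by
  have := leftPos_lt_rightPos i
  rw [simple_eq_swap]
  ext p
  simp only [mul_swap_apply]
  grind

theorem act_ite_zero {p : Prop} [Decidable p] {f g : KSpace R n} {m : RightOp R n}
    (h : p → act f m = g) : act (if p then f else 0) m = if p then g else 0 := by
  split_ifs with hp
  · exact h hp
  · exact act_zero m

theorem act_chainFactor_mul_chainFactor (σ : Perm (Fin n)) (a b c d : Fin n) :
    act (K R σ) (chainFactor R a b * chainFactor R c d) =
      (K R σ - if Cov σ a b then K R (σ * swap a b) else 0) -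
        (if Cov σ c d then K R (σ * swap c d) else 0) +
        if Cov σ a b ∧ Cov (σ * swap a b) c d then K R (σ * swap a b * swap c d) else 0 := by
  have hexpand : chainFactor R a b * chainFactor R c d =
      1 - coverOp R a b - coverOp R c d + coverOp R a b * coverOp R c d := by
    rw [chainFactor, chainFactor]; noncomm_ring
  rw [hexpand, act_op_add, act_op_sub, act_op_sub, act_one, act_coverOp, act_coverOp,
    act_coverOp_mul_coverOp]

theorem act_chainFactor_mul_chainFactor_of_lt (hc : rightPos i < c)
    (hasc : σ (leftPos i) < σ (rightPos i)) :
    act (K R σ) (chainFactor R (leftPos i) c * chainFactor R (rightPos i) c) =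
      (K R σ - if Cov σ (leftPos i) c then K R (σ * swap (leftPos i) c) else 0) -
        if Cov σ (rightPos i) c then K R (σ * swap (rightPos i) c) else 0 := by
  rw [act_chainFactor_mul_chainFactor, if_neg (c := _ ∧ _), add_zero]
  rintro ⟨-, h⟩
  exact hasc.not_gt
    (by simpa [swap_apply_of_ne_of_ne (leftPos_lt_rightPos i).ne' hc.ne] using h.2.1)

theorem rightPi_commute_chainFactor_mul_right (hc : rightPos i < c) :
    Commute (rightPi R i) (chainFactor R (leftPos i) c * chainFactor R (rightPos i) c) := by
  refine rightPi_commute_of_forall_lt fun σ hasc => ?_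
  have hlr := leftPos_lt_rightPos i
  have left_asc (h : Cov σ (leftPos i) c) :
      act (K R (σ * swap (leftPos i) c)) (rightPi R i) = K R (σ * swap (leftPos i) c) :=
    act_rightPi_of_lt (by
      simpa [swap_apply_of_ne_of_ne hlr.ne' hc.ne] using h.apply_lt_apply_rightPos hc hasc)
  have right_asc (h : Cov σ (rightPos i) c) :
      act (K R (σ * swap (rightPos i) c)) (rightPi R i) = K R (σ * swap (rightPos i) c) :=
    act_rightPi_of_lt (by
      simpa [swap_apply_of_ne_of_ne hlr.ne (hlr.trans hc).ne] using hasc.trans h.2.1)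
  have hexcl (h : Cov σ (leftPos i) c) : ¬Cov σ (rightPos i) c := fun h' =>
    h'.2.1.not_gt (h.apply_lt_apply_rightPos hc hasc)
  constructor
  · rw [act_chainFactor_mul_chainFactor_of_lt hc hasc, act_sub, act_sub, act_rightPi_of_lt hasc,
      act_ite_zero left_asc, act_ite_zero right_asc]
  rw [act_chainFactor_mul_chainFactor_of_lt hc hasc, act_chainFactor_mul_chainFactor, act_add,
    act_sub, act_sub, act_rightPi_mul_simple_of_lt hasc,
    if_congr (cov_mul_simple_right_iff hc hasc) rfl rfl,
    if_congr (cov_mul_simple_left_iff hc hasc) rfl rfl,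
    mul_simple_mul_swap_mul_swap hc, mul_simple_mul_swap_left hc, mul_simple_mul_swap_right hc,
    act_ite_zero (g := K R (σ * swap (rightPos i) c))
      fun h => (act_rightPi_mul_simple _ i).trans (right_asc h),
    act_ite_zero fun _ => act_rightPi_mul_simple _ i, act_ite_zero fun _ => rfl]
  by_cases hcov : Cov σ (leftPos i) c
  · have hdouble := mt (cov_mul_simple_left_iff hc hasc).1 (hexcl hcov)
    rw [if_pos (Or.inl hcov), if_neg (not_and_of_not_left _ hdouble), left_asc hcov, if_pos hcov,
      if_neg (hexcl hcov)]
    abel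
  · rw [if_neg hcov, if_congr (or_iff_right hcov) rfl rfl]
    abel

theorem reversal_semiconjBy_chainFactor (a b : Fin n) :
    SemiconjBy (reversal R n) (chainFactor R b.rev a.rev) (chainFactor R a b) :=
  (SemiconjBy.one_right _).sub_right (reversal_semiconjBy_coverOp a b)

theorem leftPos_rev (i : Fin (n - 1)) : leftPos i.rev = (rightPos i).rev := by
  ext; simp; omega

theorem rightPos_rev (i : Fin (n - 1)) : rightPos i.rev = (leftPos i).rev := by
  ext; simp; omega

theorem omega_conj_mul_simple (σ : Perm (Fin n)) (i : Fin (n - 1)) :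
    omega n * (σ * simple i) * omega n = omega n * σ * omega n * simple i.rev := by
  rw [simple_eq_swap, omega_conj_mul_swap, simple_eq_swap, leftPos_rev, rightPos_rev]

theorem reversal_semiconjBy_rightPi (i : Fin (n - 1)) :
    SemiconjBy (reversal R n) (rightPi R i.rev) (rightPi R i) := by
  refine rightOp_ext fun σ => ?_
  have hdesc : (omega n * σ * omega n) (rightPos i.rev) < (omega n * σ * omega n) (leftPos i.rev) ↔
      σ (rightPos i) < σ (leftPos i) := by
    simp only [leftPos_rev, rightPos_rev, Perm.mul_apply, omega_apply, Fin.rev_lt_rev, Fin.rev_rev]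
  rw [act_mul, act_mul, act_reversal, act_rightPi, act_rightPi, if_congr hdesc rfl rfl]
  split_ifs
  · rw [act_reversal, omega_conj_mul_simple]
  · rw [act_reversal]

theorem rightPi_commute_chainFactor_mul_left (hc : c < leftPos i) :
    Commute (rightPi R i) (chainFactor R c (rightPos i) * chainFactor R c (leftPos i)) := by
  have hpi := reversal_semiconjBy_rightPi (R := R) i
  have hfactor := (reversal_semiconjBy_chainFactor (R := R) c (rightPos i)).mul_right
    (reversal_semiconjBy_chainFactor c (leftPos i))
  refine eq_of_semiconjBy_reversal (hpi.mul_right hfactor) (hfactor.mul_right hpi) ?_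
  rw [← leftPos_rev, ← rightPos_rev]
  exact rightPi_commute_chainFactor_mul_right (by rwa [rightPos_rev, Fin.rev_lt_rev])

end Commutation

section PairProduct

variable {A ι : Type*} [Monoid A] {x : ι → ι → A} {m : A} {a b c : ι} {as bs cs : List ι}

/-- The ordered product of the elements `x a b` over a list of pairs `(a, b)`. -/
def pairProd (x : ι → ι → A) (L : List (ι × ι)) : A := (L.map fun p => x p.1 p.2).prod

@[simp] theorem pairProd_nil : pairProd x [] = 1 := rfl

@[simp] theorem pairProd_cons (p : ι × ι) (L : List (ι × ι)) :
    pairProd x (p :: L) = x p.1 p.2 * pairProd x L := List.prod_cons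

@[simp] theorem pairProd_append (L L' : List (ι × ι)) :
    pairProd x (L ++ L') = pairProd x L * pairProd x L' := by
  rw [pairProd, List.map_append, List.prod_append, pairProd, pairProd]

theorem commute_pairProd {L : List (ι × ι)} (h : ∀ p ∈ L, Commute m (x p.1 p.2)) :
    Commute m (pairProd x L) :=
  Commute.list_prod_right _ _ (List.forall_mem_map.2 h)

/-- The product of the `x a b` for `b` in a list. -/
def rowProd (x : ι → ι → A) (a : ι) (bs : List ι) : A := pairProd x (bs.map (Prod.mk a))

@[simp] theorem rowProd_nil : rowProd x a [] = 1 := rfl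

@[simp] theorem rowProd_cons : rowProd x a (b :: bs) = x a b * rowProd x a bs := pairProd_cons _ _

@[simp] theorem rowProd_append :
    rowProd x a (bs ++ cs) = rowProd x a bs * rowProd x a cs := by
  rw [rowProd, List.map_append, pairProd_append, rowProd, rowProd]

theorem commute_rowProd (h : ∀ b ∈ bs, Commute m (x a b)) : Commute m (rowProd x a bs) :=
  commute_pairProd (by simpa using h)

theorem pairProd_product_cons :
    pairProd x ((a :: as) ×ˢ bs) = rowProd x a bs * pairProd x (as ×ˢ bs) := by
  rw [List.product_cons, pairProd_append, rowProd]

theorem pairProd_product_append :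
    pairProd x ((as ++ bs) ×ˢ cs) = pairProd x (as ×ˢ cs) * pairProd x (bs ×ˢ cs) := by
  induction as with
  | nil => rw [List.nil_append, List.nil_product, pairProd_nil, one_mul]
  | cons a as ih =>
    rw [List.cons_append, pairProd_product_cons, pairProd_product_cons, ih, mul_assoc]

theorem commute_pairProd_product (h : ∀ a ∈ as, Commute m (rowProd x a bs)) :
    Commute m (pairProd x (as ×ˢ bs)) := by
  induction as with
  | nil => exact Commute.one_right _
  | cons a as ih =>
    rw [List.forall_mem_cons] at h
    rw [pairProd_product_cons]
    exact h.1.mul_right (ih h.2)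

/-- The elements `x a b` attached to the pairs `a < b` satisfy the Yang–Baxter equation and
commute when the pairs are disjoint. -/
structure IsYangBaxter [LinearOrder ι] (x : ι → ι → A) : Prop where
  commute : ∀ {a b c d}, a ≠ c → a ≠ d → b ≠ c → b ≠ d → Commute (x a b) (x c d)
  braid : ∀ {a b c}, a < b → b < c → x b c * x a c * x a b = x a b * x a c * x b c

namespace IsYangBaxter

variable [LinearOrder ι]

theorem commute_rowProd (hx : IsYangBaxter x) (hac : a ≠ c) (hbc : b ≠ c) (ha : a ∉ bs)
    (hb : b ∉ bs) : Commute (x a b) (rowProd x c bs) :=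
  ZeroHecke.commute_rowProd fun _ hd =>
    hx.commute hac (ne_of_mem_of_not_mem hd ha).symm hbc (ne_of_mem_of_not_mem hd hb).symm

theorem rowProd_commute_rowProd (hx : IsYangBaxter x) (hab : a ≠ b) (ha : a ∉ cs) (hb : b ∉ bs)
    (hbc : bs.Disjoint cs) : Commute (rowProd x a bs) (rowProd x b cs) :=
  Commute.symm <| ZeroHecke.commute_rowProd fun _ hd =>
    (hx.commute_rowProd hab (ne_of_mem_of_not_mem hd hb) ha (hbc hd)).symm

theorem rowProd_mul_rowProd (hx : IsYangBaxter x) (hab : a < b) (hcs : ∀ c ∈ cs, b < c)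
    (hnodup : cs.Nodup) :
    rowProd x b cs * rowProd x a cs * x a b = x a b * rowProd x a cs * rowProd x b cs := by
  induction cs with
  | nil => simp
  | cons c cs ih =>
    rw [List.forall_mem_cons] at hcs
    obtain ⟨hbc, hcs⟩ := hcs
    rw [List.nodup_cons] at hnodup
    have ha : a ∉ cs := fun h => (hab.trans (hcs a h)).false
    have hb : b ∉ cs := fun h => (hcs b h).false
    have hacb := hx.commute_rowProd hab.ne hbc.ne' ha hnodup.1
    have hbca := hx.commute_rowProd hab.ne' (hab.trans hbc).ne' hb hnodup.1
    rw [rowProd_cons, rowProd_cons]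
    calc x b c * rowProd x b cs * (x a c * rowProd x a cs) * x a b
        = x b c * (rowProd x b cs * x a c) * (rowProd x a cs * x a b) := by simp only [mul_assoc]
      _ = x b c * x a c * (rowProd x b cs * rowProd x a cs * x a b) := by
        rw [← hacb.eq]; simp only [mul_assoc]
      _ = x b c * x a c * x a b * (rowProd x a cs * rowProd x b cs) := by
        rw [ih hcs hnodup.2]; simp only [mul_assoc]
      _ = x a b * x a c * (x b c * rowProd x a cs) * rowProd x b cs := by
        rw [hx.braid hab hbc]; simp only [mul_assoc]
      _ = x a b * (x a c * rowProd x a cs) * (x b c * rowProd x b cs) := by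
        rw [hbca.eq]; simp only [mul_assoc]

theorem pairProd_product_mul_rowProd (hx : IsYangBaxter x) (has : (a :: as).Pairwise (· < ·))
    (hbs : ∀ c ∈ a :: as, ∀ b ∈ bs, c < b) (hnodup : bs.Nodup) :
    pairProd x (as ×ˢ bs) * rowProd x a bs * rowProd x a as.reverse =
      rowProd x a as.reverse * rowProd x a bs * pairProd x (as ×ˢ bs) := by
  induction as with
  | nil => simp [List.nil_product]
  | cons a' as ih =>
    simp only [List.pairwise_cons, List.forall_mem_cons] at has hbs
    obtain ⟨⟨haa', ha⟩, ha', has⟩ := has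
    obtain ⟨hab, ha'b, hasb⟩ := hbs
    have hb : bs.Disjoint as.reverse := fun c hc hc' => (hasb c (List.mem_reverse.1 hc') c hc).false
    have hrows : Commute (rowProd x a' bs) (rowProd x a as.reverse) :=
      hx.rowProd_commute_rowProd haa'.ne' (fun h => (ha' _ (List.mem_reverse.1 h)).false)
        (fun h => (hab _ h).false) hb
    have hblock : Commute (x a a') (pairProd x (as ×ˢ bs)) :=
      commute_pairProd_product fun c hc => hx.commute_rowProd (ha c hc).ne (ha' c hc).ne
        (fun h => (hab _ h).false) (fun h => (ha'b _ h).false)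
    have ih := ih (List.pairwise_cons.2 ⟨ha, has⟩) (List.forall_mem_cons.2 ⟨hab, hasb⟩)
    have hrow := hx.rowProd_mul_rowProd haa' ha'b hnodup
    rw [pairProd_product_cons, List.reverse_cons, rowProd_append, rowProd_cons, rowProd_nil,
      mul_one]
    generalize pairProd x (as ×ˢ bs) = P, rowProd x a bs = A, rowProd x a' bs = A',
      rowProd x a as.reverse = T, x a a' = y at *
    calc A' * P * A * (T * y) = A' * (P * A * T) * y := by simp only [mul_assoc]
      _ = A' * T * A * (P * y) := by rw [ih]; simp only [mul_assoc]
      _ = T * (A' * A * y) * P := by rw [hrows.eq, ← hblock.eq]; simp only [mul_assoc]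
      _ = T * y * A * (A' * P) := by rw [hrow]; simp only [mul_assoc]

end IsYangBaxter

/-- The pairs of entries of a list, in an order for which the product of a family satisfying the
Yang–Baxter equation can be cut at any place. -/
def triangle : List ι → List (ι × ι)
  | [] => []
  | a :: as => triangle as ++ as.reverse.map (Prod.mk a)

theorem pairProd_triangle_cons :
    pairProd x (triangle (a :: as)) = pairProd x (triangle as) * rowProd x a as.reverse := by
  rw [triangle, pairProd_append, rowProd]

theorem lt_of_mem_triangle [Preorder ι] (has : as.Pairwise (· < ·)) {p : ι × ι}
    (hp : p ∈ triangle as) : p.1 < p.2 := by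
  induction as with
  | nil => simp [triangle] at hp
  | cons a as ih =>
    rw [List.pairwise_cons] at has
    rw [triangle, List.mem_append] at hp
    rcases hp with hp | hp
    · exact ih has.2 hp
    · obtain ⟨b, hb, rfl⟩ := List.mem_map.1 hp
      exact has.1 b (List.mem_reverse.1 hb)

theorem mem_of_mem_triangle {p : ι × ι} (hp : p ∈ triangle as) : p.1 ∈ as ∧ p.2 ∈ as := by
  induction as with
  | nil => simp [triangle] at hp
  | cons a as ih =>
    rw [triangle, List.mem_append] at hp
    rcases hp with hp | hp
    · exact (ih hp).imp (List.mem_cons_of_mem a) (List.mem_cons_of_mem a)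
    · obtain ⟨b, hb, rfl⟩ := List.mem_map.1 hp
      exact ⟨List.mem_cons_self, List.mem_cons_of_mem a (List.mem_reverse.1 hb)⟩

theorem IsYangBaxter.pairProd_triangle_commute [LinearOrder ι] (hx : IsYangBaxter x)
    (h : as.Disjoint bs) :
    Commute (pairProd x (triangle as)) (pairProd x (triangle bs)) := by
  refine commute_pairProd fun p hp => (commute_pairProd fun q hq => ?_).symm
  have hne {a b : ι} (ha : a ∈ as) (hb : b ∈ bs) : b ≠ a := (ne_of_mem_of_not_mem ha (h · hb)).symm
  obtain ⟨hp₁, hp₂⟩ := mem_of_mem_triangle hp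
  obtain ⟨hq₁, hq₂⟩ := mem_of_mem_triangle hq
  exact hx.commute (hne hq₁ hp₁) (hne hq₂ hp₁) (hne hq₁ hp₂) (hne hq₂ hp₂)

theorem IsYangBaxter.pairProd_triangle_append [LinearOrder ι] (hx : IsYangBaxter x)
    (h : (as ++ bs).Pairwise (· < ·)) :
    pairProd x (triangle (as ++ bs)) =
      pairProd x (triangle bs) * pairProd x (triangle as) * pairProd x (as ×ˢ bs.reverse) := by
  induction as with
  | nil => simp [triangle, List.nil_product]
  | cons a as ih =>
    rw [List.cons_append, List.pairwise_cons] at h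
    obtain ⟨has, hbs, hlt⟩ := List.pairwise_append.1 h.2
    have hcut := hx.pairProd_product_mul_rowProd (a := a) (as := as) (bs := bs.reverse)
      (List.pairwise_cons.2 ⟨fun b hb => h.1 b (List.mem_append_left _ hb), has⟩)
      (fun c hc b hb => by
        rw [List.mem_reverse] at hb
        rcases List.mem_cons.1 hc with rfl | hc
        · exact h.1 b (List.mem_append_right _ hb)
        · exact hlt c hc b hb)
      (List.nodup_reverse.2 (hbs.imp fun hlt => hlt.ne))
    rw [List.cons_append, pairProd_triangle_cons, ih h.2, List.reverse_append, rowProd_append,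
      pairProd_triangle_cons, pairProd_product_cons]
    generalize pairProd x (as ×ˢ bs.reverse) = P, rowProd x a bs.reverse = A,
      rowProd x a as.reverse = B at *
    calc _ = pairProd x (triangle bs) * pairProd x (triangle as) * (P * A * B) := by
          simp only [mul_assoc]
      _ = _ := by rw [hcut]; simp only [mul_assoc]

theorem IsYangBaxter.pairProd_triangle_cons_cons [LinearOrder ι] (hx : IsYangBaxter x)
    (h : (a :: b :: cs).Pairwise (· < ·)) :
    pairProd x (triangle (a :: b :: cs)) =
      x a b * (pairProd x (triangle cs) * (rowProd x a cs.reverse * rowProd x b cs.reverse)) := by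
  simp only [List.pairwise_cons, List.forall_mem_cons] at h
  obtain ⟨⟨hab, ha⟩, hb, hcs⟩ := h
  have hrows := hx.rowProd_mul_rowProd hab (fun c hc => hb c (List.mem_reverse.1 hc))
    (List.nodup_reverse.2 (hcs.imp fun hlt => hlt.ne))
  have htri : Commute (x a b) (pairProd x (triangle cs)) := commute_pairProd fun p hp => by
    obtain ⟨h₁, h₂⟩ := mem_of_mem_triangle hp
    exact hx.commute (ha _ h₁).ne (ha _ h₂).ne (hb _ h₁).ne (hb _ h₂).ne
  rw [pairProd_triangle_cons, pairProd_triangle_cons, List.reverse_cons, rowProd_append,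
    rowProd_cons, rowProd_nil, mul_one, ← mul_assoc, htri.left_comm, mul_assoc, mul_assoc,
    ← mul_assoc (rowProd x b _), hrows, mul_assoc]

end PairProduct

section Positions

variable {n p q r : ℕ} {a : Fin n} {i : Fin (n - 1)}

/-- The list of the positions `a` with `p ≤ a < q`, in increasing order. -/
def positions (n p q : ℕ) : List (Fin n) :=
  (List.finRange n).filter fun a => p ≤ a.val ∧ a.val < q

@[simp] theorem mem_positions : a ∈ positions n p q ↔ p ≤ a.val ∧ a.val < q := by
  simp [positions]

theorem positions_pairwise_lt (n p q : ℕ) : (positions n p q).Pairwise (· < ·) :=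
  (List.pairwise_lt_finRange n).filter _

theorem positions_nodup (n p q : ℕ) : (positions n p q).Nodup := (List.nodup_finRange n).filter _

theorem eq_of_pairwise_lt_of_mem_iff {as bs : List (Fin n)} (has : as.Pairwise (· < ·))
    (hbs : bs.Pairwise (· < ·)) (h : ∀ a, a ∈ as ↔ a ∈ bs) : as = bs :=
  ((List.perm_ext_iff_of_nodup (has.imp fun hlt => hlt.ne) (hbs.imp fun hlt => hlt.ne)).2
    h).eq_of_pairwise (fun _ _ _ _ hab hba => (hab.not_gt hba).elim) has hbs

theorem positions_append (hpq : p ≤ q) (hqr : q ≤ r) :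
    positions n p q ++ positions n q r = positions n p r := by
  refine eq_of_pairwise_lt_of_mem_iff (List.pairwise_append.2 ⟨positions_pairwise_lt n p q,
    positions_pairwise_lt n q r, fun a ha b hb => ?_⟩) (positions_pairwise_lt n p r) fun a => ?_
  · rw [mem_positions] at ha hb
    exact ha.2.trans_le hb.1
  · rw [List.mem_append, mem_positions, mem_positions, mem_positions]
    omega

theorem positions_eq_append_cons_cons (hp : p ≤ i) (hq : i + 1 < q) :
    positions n p q =
      positions n p i ++ leftPos i :: rightPos i :: positions n (i + 2) q := by
  have hmid : positions n i (i + 2) = [leftPos i, rightPos i] := by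
    refine eq_of_pairwise_lt_of_mem_iff (positions_pairwise_lt n _ _)
      (List.pairwise_pair.2 (leftPos_lt_rightPos i)) fun a => ?_
    simp only [mem_positions, List.mem_cons, List.not_mem_nil, or_false, Fin.ext_iff]
    omega
  rw [← positions_append hp (by omega), ← positions_append (q := i + 2) (by omega) hq, hmid]
  rfl

theorem blockList_eq_product {m : ℕ} (k : Fin m → ℕ) (j : Fin m) :
    blockList n k j = positions n (prevCut k j) (k j) ×ˢ (positions n (k j) n).reverse := by
  rw [blockList, positions, positions, ← List.filter_reverse]
  simp only [Fin.is_lt, and_true]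
  rfl

theorem transpList_succ {m : ℕ} (k : Fin (m + 1) → ℕ) :
    transpList n k = blockList n k (Fin.last m) ++ transpList n (k ∘ Fin.castSucc) := by
  rw [transpList, List.finRange_succ_last, List.reverse_append, List.flatMap_append,
    ← List.map_reverse, List.flatMap_map, List.reverse_singleton, List.flatMap_singleton]
  rfl

/-- The last cut, with the convention `k₀ = 0`. -/
def lastCut : {m : ℕ} → (Fin m → ℕ) → ℕ
  | 0, _ => 0
  | m + 1, k => k (Fin.last m)

theorem prevCut_last {m : ℕ} (k : Fin (m + 1) → ℕ) :
    prevCut k (Fin.last m) = lastCut (k ∘ Fin.castSucc) := by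
  cases m <;> rfl

theorem prevCut_le {m : ℕ} {k : Fin m → ℕ} (hk : StrictMono k) (j : Fin m) :
    prevCut k j ≤ k j := by
  unfold prevCut
  split_ifs
  · exact Nat.zero_le _
  · exact hk.monotone (Fin.le_def.2 (Nat.sub_le _ _))

theorem le_lastCut {m : ℕ} {k : Fin m → ℕ} (hk : StrictMono k) (j : Fin m) : k j ≤ lastCut k := by
  cases m with
  | zero => exact j.elim0
  | succ m => exact hk.monotone (Fin.le_last j)

/-- The positions `a < b` lie in the same block. -/
def SameBlock {m : ℕ} (k : Fin m → ℕ) (a b : Fin n) : Prop :=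
  a < b ∧ ∀ j, a.val < k j ↔ b.val < k j

theorem mem_transpList {m : ℕ} {k : Fin m → ℕ} {p : Fin n × Fin n} (hp : p ∈ transpList n k) :
    p.1 < p.2 ∧ ¬SameBlock k p.1 p.2 := by
  rw [transpList, List.mem_flatMap] at hp
  obtain ⟨j, -, hp⟩ := hp
  rw [blockList_eq_product] at hp
  obtain ⟨hleft, hright⟩ := List.pair_mem_product.1 hp
  rw [List.mem_reverse, mem_positions] at hright
  rw [mem_positions] at hleft
  exact ⟨by omega, fun h => by have := h.2 j; omega⟩

theorem nodup_transpList {m : ℕ} {k : Fin m → ℕ} (hk : StrictMono k) :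
    (transpList n k).Nodup := by
  induction m with
  | zero => exact List.nodup_nil
  | succ m ih =>
    rw [transpList_succ, blockList_eq_product]
    refine ((positions_nodup n _ _).product (List.nodup_reverse.2 (positions_nodup n _ _))).append
      (ih (hk.comp Fin.strictMono_castSucc)) fun p hp hp' => ?_
    obtain ⟨hlt, hcut⟩ := mem_transpList hp'
    obtain ⟨hleft, -⟩ := List.pair_mem_product.1 hp
    rw [mem_positions, prevCut_last] at hleft
    refine hcut ⟨hlt, fun j => ?_⟩
    have hj := le_lastCut (hk.comp Fin.strictMono_castSucc) j
    omega

end Positions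

section FullProduct

variable {R : Type*} [CommRing R] {n m : ℕ} {i : Fin (n - 1)} {a : Fin n} {bs cs : List (Fin n)}
  {k : Fin m → ℕ}

theorem isYangBaxter_chainFactor : IsYangBaxter (chainFactor R (n := n)) where
  commute := chainFactor_commute
  braid := chainFactor_yang_baxter

theorem rightPi_commute_rowProd (hal : a ≠ leftPos i) (har : a ≠ rightPos i)
    (hl : leftPos i ∉ bs) (hr : rightPos i ∉ bs) :
    Commute (rightPi R i) (rowProd (chainFactor R) a bs) :=
  commute_rowProd fun _ hb => rightPi_commute_chainFactor hal har (ne_of_mem_of_not_mem hb hl)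
    (ne_of_mem_of_not_mem hb hr)

theorem rightPi_commute_rowProd_of_lt (ha : a < leftPos i) (hbl : leftPos i ∉ bs)
    (hbr : rightPos i ∉ bs) (hcl : leftPos i ∉ cs) (hcr : rightPos i ∉ cs) :
    Commute (rightPi R i)
      (rowProd (chainFactor R) a (bs ++ rightPos i :: leftPos i :: cs)) := by
  have hal := ha.ne
  have har := (ha.trans (leftPos_lt_rightPos i)).ne
  rw [rowProd_append, rowProd_cons, rowProd_cons, ← mul_assoc (chainFactor R a _)]
  exact (rightPi_commute_rowProd hal har hbl hbr).mul_right
    ((rightPi_commute_chainFactor_mul_left ha).mul_right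
      (rightPi_commute_rowProd hal har hcl hcr))

theorem rightPi_commute_rowProd_mul_rowProd (hcs : ∀ c ∈ cs, rightPos i < c) (hnodup : cs.Nodup) :
    Commute (rightPi R i)
      (rowProd (chainFactor R) (leftPos i) cs * rowProd (chainFactor R) (rightPos i) cs) := by
  induction cs with
  | nil => simp
  | cons c cs ih =>
    rw [List.forall_mem_cons] at hcs
    rw [List.nodup_cons] at hnodup
    have hlr := leftPos_lt_rightPos i
    have hcomm : Commute (chainFactor R (rightPos i) c)
        (rowProd (chainFactor R) (leftPos i) cs) :=
      isYangBaxter_chainFactor.commute_rowProd hlr.ne' (hlr.trans hcs.1).ne'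
        (fun h => (hcs.2 _ h).false) hnodup.1
    rw [rowProd_cons, rowProd_cons, mul_assoc, ← mul_assoc _ (chainFactor R _ c), ← hcomm.eq,
      mul_assoc, ← mul_assoc]
    exact (rightPi_commute_chainFactor_mul_right hcs.1).mul_right (ih hcs.2 hnodup.2)

theorem rightPi_commute_pairProd_product_positions {p q r : ℕ} (hpi : p ≠ i + 1)
    (hqi : q ≠ i + 1) (hri : r ≠ i + 1) :
    Commute (rightPi R i)
      (pairProd (chainFactor R) (positions n p q ×ˢ (positions n q r).reverse)) := by
  rcases le_or_gt p i with hp | hp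
  · rcases le_or_gt q i with hq | hq
    · refine commute_pairProd_product fun a ha => ?_
      have hai : a < leftPos i := by rw [mem_positions] at ha; exact ha.2.trans_le hq
      rcases le_or_gt r i with hr | hr
      · exact rightPi_commute_rowProd hai.ne (hai.trans (leftPos_lt_rightPos i)).ne
          (by simp; omega) (by simp; omega)
      · rw [positions_eq_append_cons_cons hq (by omega), List.reverse_append, List.reverse_cons,
          List.reverse_cons, List.append_assoc, List.append_assoc]
        exact rightPi_commute_rowProd_of_lt hai (by simp) (by simp) (by simp) (by simp)
    · rw [positions_eq_append_cons_cons hp (by omega), pairProd_product_append,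
        pairProd_product_cons, pairProd_product_cons, ← mul_assoc (rowProd _ _ _)]
      have hnodup := List.nodup_reverse.2 (positions_nodup n q r)
      refine (commute_pairProd_product fun a ha => ?_).mul_right
        ((rightPi_commute_rowProd_mul_rowProd ?_ hnodup).mul_right
          (commute_pairProd_product fun a ha => ?_))
      · rw [mem_positions] at ha
        refine rightPi_commute_rowProd ?_ ?_ ?_ ?_ <;> simp [Fin.ext_iff] <;> omega
      · intro c hc
        rw [List.mem_reverse, mem_positions] at hc
        exact Fin.lt_def.2 (by simp; omega)
      · rw [mem_positions] at ha
        refine rightPi_commute_rowProd ?_ ?_ ?_ ?_ <;> simp [Fin.ext_iff] <;> omega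
  · refine commute_pairProd_product fun a ha => ?_
    rw [mem_positions] at ha
    refine rightPi_commute_rowProd ?_ ?_ ?_ ?_ <;> simp [Fin.ext_iff] <;> omega

theorem rightPi_commute_transpList (hi : ∀ j, k j ≠ i + 1) :
    Commute (rightPi R i) (pairProd (chainFactor R) (transpList n k)) := by
  induction m with
  | zero => exact Commute.one_right _
  | succ m ih =>
    rw [transpList_succ, pairProd_append, blockList_eq_product]
    refine (rightPi_commute_pairProd_product_positions ?_ (hi _) (by omega)).mul_right
      (ih fun j => hi j.castSucc)
    unfold prevCut
    split_ifs
    exacts [by omega, hi _]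

variable (R n) in
/-- The product of the operators `chainFactor R a b` over all the pairs `a < b`. -/
noncomputable def fullProd : RightOp R n := pairProd (chainFactor R) (triangle (positions n 0 n))

theorem rightPi_commute_pairProd_triangle (h : ∀ b ∈ bs, b ≠ leftPos i ∧ b ≠ rightPos i) :
    Commute (rightPi R i) (pairProd (chainFactor R) (triangle bs)) :=
  commute_pairProd fun _ hp =>
    have hmem := mem_of_mem_triangle hp
    rightPi_commute_chainFactor (h _ hmem.1).1 (h _ hmem.1).2 (h _ hmem.2).1 (h _ hmem.2).2

variable (R) in
theorem exists_fullProd_eq (i : Fin (n - 1)) : ∃ T, Commute (rightPi R i) T ∧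
    fullProd R n = chainFactor R (leftPos i) (rightPos i) * T := by
  have hx := isYangBaxter_chainFactor (R := R) (n := n)
  have hlr := leftPos_lt_rightPos i
  have hsplit := positions_eq_append_cons_cons (n := n) (Nat.zero_le i) (q := n) (by omega)
  have hsorted := hsplit ▸ positions_pairwise_lt n 0 n
  rw [fullProd, hsplit, hx.pairProd_triangle_append hsorted,
    hx.pairProd_triangle_cons_cons (List.pairwise_append.1 hsorted).2.1]
  set as := positions n 0 i
  set cs := positions n (i + 2) n
  have has {a : Fin n} (ha : a ∈ as) : a < leftPos i := (mem_positions.1 ha).2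
  have hcs {c : Fin n} (hc : c ∈ cs) : rightPos i < c := (mem_positions.1 hc).1
  have hright : Commute (rightPi R i) (pairProd (chainFactor R) (triangle cs)) :=
    rightPi_commute_pairProd_triangle fun c hc => ⟨(hlr.trans (hcs hc)).ne', (hcs hc).ne'⟩
  have hrows := rightPi_commute_rowProd_mul_rowProd (R := R)
    (fun c hc => hcs (List.mem_reverse.1 hc)) (List.nodup_reverse.2 (positions_nodup n _ _))
  have hleft : Commute (rightPi R i) (pairProd (chainFactor R) (triangle as)) :=
    rightPi_commute_pairProd_triangle fun a ha => ⟨(has ha).ne, ((has ha).trans hlr).ne⟩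
  refine ⟨_, (hright.mul_right hrows).mul_right (hleft.mul_right
    (commute_pairProd_product fun a ha => ?_)), (mul_assoc _ _ _).trans (mul_assoc _ _ _)⟩
  rw [List.reverse_cons, List.reverse_cons, List.append_assoc]
  exact rightPi_commute_rowProd_of_lt (has ha)
    (fun h => (hlr.trans (hcs (List.mem_reverse.1 h))).false)
    (fun h => (hcs (List.mem_reverse.1 h)).false) List.not_mem_nil List.not_mem_nil

theorem exists_fullProd_eq_mul_triangle_mul (hk : StrictMono k) (hkn : ∀ j, k j < n) :
    ∃ L, (∀ p ∈ L, SameBlock k p.1 p.2 ∧ p.2 < lastCut k) ∧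
      fullProd R n = pairProd (chainFactor R) L *
        pairProd (chainFactor R) (triangle (positions n (lastCut k) n)) *
          pairProd (chainFactor R) (transpList n k) := by
  induction m with
  | zero => exact ⟨[], by simp, by simp [fullProd, lastCut, transpList]⟩
  | succ m ih =>
    set k' := k ∘ Fin.castSucc
    have hk' : StrictMono k' := hk.comp Fin.strictMono_castSucc
    obtain ⟨L, hL, hfull⟩ := ih hk' fun j => hkn j.castSucc
    have hle : lastCut k' ≤ lastCut k := prevCut_last k ▸ prevCut_le hk (Fin.last m)
    have hsplit := positions_append (n := n) hle (hkn (Fin.last m)).le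
    have htri := (isYangBaxter_chainFactor (R := R)).pairProd_triangle_commute
      (List.disjoint_of_nodup_append (hsplit ▸ positions_nodup n (lastCut k') n))
    refine ⟨L ++ triangle (positions n (lastCut k') (lastCut k)), fun p hp => ?_, ?_⟩
    · rcases List.mem_append.1 hp with hp | hp
      · obtain ⟨hblock, hlt⟩ := hL p hp
        refine ⟨⟨hblock.1, Fin.lastCases ?_ hblock.2⟩, hlt.trans_le hle⟩
        have := hblock.1
        change p.1 < lastCut k ↔ p.2 < lastCut k
        omega
      · have hlt := lt_of_mem_triangle (positions_pairwise_lt n _ _) hp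
        have hp := mem_of_mem_triangle hp
        simp only [mem_positions] at hp
        refine ⟨⟨hlt, Fin.lastCases (iff_of_true hp.1.2 hp.2.2) fun j => ?_⟩, hp.2.2⟩
        have hj := le_lastCut hk' j
        change p.1 < k' j ↔ p.2 < k' j
        omega
    · rw [hfull, ← hsplit, isYangBaxter_chainFactor.pairProd_triangle_append
        (hsplit ▸ positions_pairwise_lt n _ _), transpList_succ, blockList_eq_product, prevCut_last,
        pairProd_append, pairProd_append, ← htri.eq]
      simp only [mul_assoc]
      rfl

theorem exists_fullProd_eq_pairProd (hk : StrictMono k) (hkn : ∀ j, k j < n) :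
    ∃ L, (∀ p ∈ L, SameBlock k p.1 p.2) ∧
      fullProd R n = pairProd (chainFactor R) (L ++ transpList n k) := by
  obtain ⟨L, hL, hfull⟩ := exists_fullProd_eq_mul_triangle_mul (R := R) hk hkn
  refine ⟨L ++ triangle (positions n (lastCut k) n), fun p hp => ?_, ?_⟩
  · rcases List.mem_append.1 hp with hp | hp
    · exact (hL p hp).1
    · refine ⟨lt_of_mem_triangle (positions_pairwise_lt n _ _) hp, fun j => ?_⟩
      have hmem := mem_of_mem_triangle hp
      rw [mem_positions, mem_positions] at hmem
      have hj := le_lastCut hk j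
      omega
  · rw [hfull, pairProd_append, pairProd_append]

end FullProduct

section Expansion

variable {R : Type*} [CommRing R] {n m : ℕ} {σ τ ζ : Perm (Fin n)} {i : Fin (n - 1)}
  {k : Fin m → ℕ} {u v : List (Fin (n - 1))} {L : List (Fin n × Fin n)}

theorem act_pairProd_cons (σ : Perm (Fin n)) (p : Fin n × Fin n) (L : List (Fin n × Fin n)) :
    act (K R σ) (pairProd (chainFactor R) (p :: L)) = act (K R σ) (pairProd (chainFactor R) L) -
      if Cov σ p.1 p.2 then act (K R (σ * swap p.1 p.2)) (pairProd (chainFactor R) L) else 0 := by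
  rw [pairProd_cons, act_mul, act_chainFactor, act_sub, act_ite, act_zero]

theorem act_pairProd_of_not_cov (h : ∀ p ∈ L, ¬Cov σ p.1 p.2) :
    act (K R σ) (pairProd (chainFactor R) L) = K R σ := by
  induction L with
  | nil => exact act_one _
  | cons p L ih =>
    rw [List.forall_mem_cons] at h
    rw [act_pairProd_cons, if_neg h.1, sub_zero, ih h.2]

theorem act_omega_fullProd : act (K R (omega n)) (fullProd R n) = K R (omega n) :=
  act_pairProd_of_not_cov fun _ hp hcov =>
    (Fin.rev_lt_rev.1 hcov.2.1).not_gt (lt_of_mem_triangle (positions_pairwise_lt n 0 n) hp)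

theorem act_mul_simple_fullProd (h : σ (rightPos i) < σ (leftPos i)) :
    act (K R (σ * simple i)) (fullProd R n) =
      act (act (K R σ) (fullProd R n)) (rightPi R i) - act (K R σ) (fullProd R n) := by
  obtain ⟨T, hcomm, hfull⟩ := exists_fullProd_eq R i
  have hcov : Cov (σ * simple i) (leftPos i) (rightPos i) :=
    cov_leftPos_rightPos_iff.2 (by simpa using h)
  have hσ : act (K R σ) (fullProd R n) = act (K R σ) T := by
    rw [hfull, act_mul, act_chainFactor, if_neg fun h' => h.not_gt h'.2.1, sub_zero]
  rw [hσ, hfull, act_mul, act_chainFactor, if_pos hcov, ← simple_eq_swap, mul_simple_mul_simple,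
    ← act_mul, ← hcomm.eq, act_mul, act_rightPi, if_pos h, act_sub]

theorem IsReducedWord.of_concat (h : IsReducedWord (u ++ [i]) τ) :
    IsReducedWord u (τ * simple i) ∧ τ (rightPos i) < τ (leftPos i) := by
  obtain ⟨rfl, hlen⟩ := h
  rw [wordProd_concat, len_eq_invCount, List.length_append, List.length_singleton] at hlen
  have hle := invCount_wordProd_le u
  rw [wordProd_concat, mul_simple_mul_simple]
  rcases lt_or_gt_of_ne (apply_leftPos_ne (wordProd u) i) with hasc | hdesc
  · rw [invCount_mul_simple hasc] at hlen
    exact ⟨⟨rfl, by rw [len_eq_invCount]; omega⟩, by simpa using hasc⟩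
  · have := invCount_mul_simple' hdesc
    omega

theorem piWord_concat (f : KSpace R n) (v : List (Fin (n - 1))) (i : Fin (n - 1)) :
    piWord f (v ++ [i]) = act (piWord f v) (rightPi R i) := List.foldl_concat ..

theorem piHatWord_concat (f : KSpace R n) (u : List (Fin (n - 1))) (i : Fin (n - 1)) :
    piHatWord f (u ++ [i]) = act (piHatWord f u) (rightPi R i) - piHatWord f u :=
  List.foldl_concat ..

theorem piHatWord_omega (h : IsReducedWord u τ) :
    piHatWord (K R (omega n)) u = act (K R (omega n * τ)) (fullProd R n) := by
  induction u using List.reverseRecOn generalizing τ with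
  | nil =>
    obtain rfl : 1 = τ := h.1
    rw [mul_one, act_omega_fullProd]
    rfl
  | append_singleton u i ih =>
    obtain ⟨hu, hdesc⟩ := h.of_concat
    have hdesc' : (omega n * (τ * simple i)) (rightPos i) <
        (omega n * (τ * simple i)) (leftPos i) := by
      simpa only [Perm.mul_apply, simple_leftPos, simple_rightPos, omega_apply] using
        Fin.rev_lt_rev.2 hdesc
    rw [piHatWord_concat, ih hu, ← act_mul_simple_fullProd hdesc', mul_assoc,
      mul_simple_mul_simple]

theorem sameBlock_leftPos_rightPos_iff :
    SameBlock k (leftPos i) (rightPos i) ↔ ∀ j, k j ≠ i + 1 := by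
  refine ⟨fun h j hj => ?_, fun h => ⟨leftPos_lt_rightPos i, fun j => ?_⟩⟩
  · have := h.2 j
    simp only at this
    omega
  · have := h j
    simp only
    omega

theorem swap_mem_parabolic {a b : Fin n} (h : SameBlock k a b) :
    swap a b ∈ parabolic (n := n) k := fun j x => by
  rw [swap_apply_def]
  split_ifs with hl hr
  · rw [hl, h.2 j]
  · rw [hr, h.2 j]
  · rfl

theorem sameBlock_of_apply_lt (hτ : τ ∈ parabolic (n := n) k) {a b : Fin n} (hab : a < b)
    (h : τ b < τ a) : SameBlock k (τ b) (τ a) ∧ SameBlock k a b := by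
  have hblock (j : Fin m) : a.val < k j ↔ b.val < k j := by
    have ha := hτ j a
    have hb := hτ j b
    omega
  exact ⟨⟨h, fun j => by rw [hτ j, hτ j, hblock]⟩, hab, hblock⟩

/-- The permutation `ζ` is decreasing on each block of positions; this describes the maximal
elements of the cosets of `parabolic k`. -/
def DecreasingOnBlocks (k : Fin m → ℕ) (ζ : Perm (Fin n)) : Prop :=
  ∀ a b, SameBlock k a b → ζ b < ζ a

theorem piWord_act_transpList (hζ : DecreasingOnBlocks k ζ) (hv : IsReducedWord v τ)
    (hτ : τ ∈ parabolic (n := n) k) :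
    piWord (act (K R ζ) (pairProd (chainFactor R) (transpList n k))) v =
      act (K R (ζ * τ)) (pairProd (chainFactor R) (transpList n k)) := by
  induction v using List.reverseRecOn generalizing τ with
  | nil =>
    obtain rfl : 1 = τ := hv.1
    rw [mul_one]
    rfl
  | append_singleton v i ih =>
    obtain ⟨hv, hdesc⟩ := hv.of_concat
    obtain ⟨himage, hblock⟩ := sameBlock_of_apply_lt hτ (leftPos_lt_rightPos i) hdesc
    have hdesc' : (ζ * (τ * simple i)) (rightPos i) < (ζ * (τ * simple i)) (leftPos i) := by
      simpa only [Perm.mul_apply, simple_leftPos, simple_rightPos] using hζ _ _ himage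
    rw [piWord_concat, ih hv (mul_mem hτ (swap_mem_parabolic hblock)), ← act_mul,
      ← (rightPi_commute_transpList (sameBlock_leftPos_rightPos_iff.1 hblock)).eq, act_mul,
      act_rightPi, if_pos hdesc', mul_assoc, mul_simple_mul_simple]

theorem piWord_piHatWord_omega (hk : StrictMono k) (hkn : ∀ j, k j < n)
    (hζ : DecreasingOnBlocks k ζ) (hσ : ζ⁻¹ * σ ∈ parabolic (n := n) k)
    (hu : IsReducedWord u (omega n * ζ)) (hv : IsReducedWord v (ζ⁻¹ * σ)) :
    piWord (piHatWord (K R (omega n)) u) v =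
      act (K R σ) (pairProd (chainFactor R) (transpList n k)) := by
  obtain ⟨L, hL, hfull⟩ := exists_fullProd_eq_pairProd (R := R) hk hkn
  rw [piHatWord_omega hu, omega_mul_omega_mul, hfull, pairProd_append, act_mul,
    act_pairProd_of_not_cov fun p hp hcov => (hζ _ _ (hL p hp)).not_gt hcov.2.1,
    piWord_act_transpList hζ hv hσ, mul_inv_cancel_left]

end Expansion

section Paths

variable {R : Type*} [CommRing R] {n m : ℕ} {σ μ : Perm (Fin n)} {k : Fin m → ℕ}
  {p : Fin n × Fin n} {L w w' : List (Fin n × Fin n)}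

@[simp] theorem mulWord_nil (σ : Perm (Fin n)) : mulWord σ [] = σ := mul_one σ

@[simp] theorem mulWord_cons (σ : Perm (Fin n)) (p : Fin n × Fin n) (w : List (Fin n × Fin n)) :
    mulWord σ (p :: w) = mulWord (σ * swap p.1 p.2) w := by
  simp [mulWord, mul_assoc]

theorem mulWord_append (σ : Perm (Fin n)) (w w' : List (Fin n × Fin n)) :
    mulWord σ (w ++ w') = mulWord (mulWord σ w) w' := by
  simp [mulWord, mul_assoc]

theorem isBruhatPath_cons (hp : p.1 < p.2) :
    IsBruhatPath σ (p :: w) ↔ Cov σ p.1 p.2 ∧ IsBruhatPath (σ * swap p.1 p.2) w := by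
  rw [IsBruhatPath, isBruhatTransposition_swap_iff_cov hp]

theorem isBruhatPath_append :
    IsBruhatPath σ (w ++ w') ↔ IsBruhatPath σ w ∧ IsBruhatPath (mulWord σ w) w' := by
  induction w generalizing σ with
  | nil => simp [IsBruhatPath]
  | cons p w ih => rw [List.cons_append, IsBruhatPath, IsBruhatPath, ih, mulWord_cons, and_assoc]

theorem IsBruhatPath.invCount_mulWord (h : IsBruhatPath σ w) :
    invCount (mulWord σ w) = invCount σ + w.length := by
  induction w generalizing σ with
  | nil => rfl
  | cons p w ih =>
    have hlen := h.1.2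
    rw [len_eq_invCount, len_eq_invCount] at hlen
    rw [mulWord_cons, ih h.2, hlen, List.length_cons]
    omega

theorem IsBruhatPath.bruhatLE (h : IsBruhatPath σ w) : BruhatLE σ (mulWord σ w) := by
  induction w generalizing σ with
  | nil => exact bruhatLE_refl σ
  | cons p w ih =>
    rw [mulWord_cons]
    exact (Relation.ReflTransGen.single ⟨_, h.1, rfl⟩).trans (ih h.2)

open Classical in
/-- The subwords of `L` that are paths in the Bruhat order starting from `σ`, with multiplicity. -/
noncomputable def bruhatPaths (L : List (Fin n × Fin n)) (σ : Perm (Fin n)) :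
    List (List (Fin n × Fin n)) :=
  L.sublists'.filter fun w => IsBruhatPath σ w

theorem mem_bruhatPaths : w ∈ bruhatPaths L σ ↔ w.Sublist L ∧ IsBruhatPath σ w := by
  simp [bruhatPaths]

theorem bruhatPaths_cons (hp : p.1 < p.2) : bruhatPaths (p :: L) σ = bruhatPaths L σ ++
    if Cov σ p.1 p.2 then (bruhatPaths L (σ * swap p.1 p.2)).map (List.cons p) else [] := by
  classical
  rw [bruhatPaths, List.sublists'_cons, List.filter_append, List.filter_map, bruhatPaths]
  congr 1
  split_ifs with h
  · rw [bruhatPaths]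
    congr 1
    refine List.filter_congr fun w _ => ?_
    rw [Function.comp_apply, decide_eq_decide, isBruhatPath_cons hp, and_iff_right h]
  · rw [List.map_eq_nil_iff, List.filter_eq_nil_iff]
    intro w _ hw
    rw [Function.comp_apply, decide_eq_true_eq, isBruhatPath_cons hp] at hw
    exact h hw.1

theorem act_pairProd_eq_sum (hL : ∀ p ∈ L, p.1 < p.2) (σ : Perm (Fin n)) :
    act (K R σ) (pairProd (chainFactor R) L) =
      ((bruhatPaths L σ).map fun w => (-1 : R) ^ w.length • K R (mulWord σ w)).sum := by
  induction L generalizing σ with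
  | nil =>
    have hnil : bruhatPaths [] σ = [[]] := by
      rw [bruhatPaths, List.sublists'_nil]
      exact List.filter_eq_self.2 (by simp [IsBruhatPath])
    simp [hnil]
  | cons p L ih =>
    rw [List.forall_mem_cons] at hL
    rw [act_pairProd_cons, ih hL.2, bruhatPaths_cons hL.1, List.map_append, List.sum_append,
      sub_eq_add_neg]
    congr 1
    split_ifs
    · rw [ih hL.2, List.map_map, List.sum_neg, List.map_map]
      simp [Function.comp_def, pow_succ]
    · simp

theorem chainSum_eq_act (hk : StrictMono k) (σ : Perm (Fin n)) :
    chainSum R k σ = act (K R σ) (pairProd (chainFactor R) (transpList n k)) := by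
  classical
  have hnodup : (bruhatPaths (transpList n k) σ).Nodup :=
    (List.nodup_sublists'.2 (nodup_transpList hk)).filter _
  rw [act_pairProd_eq_sum (fun p hp => (mem_transpList hp).1), ← List.sum_toFinset _ hnodup,
    chainSum]
  congr 1
  ext w
  simp [validSubwords, mem_bruhatPaths]

theorem K_apply (σ μ : Perm (Fin n)) : K R σ μ = if σ = μ then 1 else 0 := Finsupp.single_apply

theorem act_pairProd_apply (hL : ∀ p ∈ L, p.1 < p.2) (σ μ : Perm (Fin n)) :
    act (K R σ) (pairProd (chainFactor R) L) μ =
      (-1) ^ (invCount σ + invCount μ) * ((bruhatPaths L σ).map (mulWord σ)).count μ := by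
  have hpath : ∀ w ∈ bruhatPaths L σ, invCount (mulWord σ w) = invCount σ + w.length :=
    fun w hw => (mem_bruhatPaths.1 hw).2.invCount_mulWord
  rw [act_pairProd_eq_sum hL]
  revert hpath
  induction bruhatPaths L σ with
  | nil => simp
  | cons w l ih =>
    intro hpath
    rw [List.forall_mem_cons] at hpath
    rw [List.map_cons, List.sum_cons, Finsupp.add_apply, ih hpath.2, Finsupp.smul_apply, K_apply,
      List.map_cons, List.count_cons]
    by_cases hw : mulWord σ w = μ
    · have hsign : (-1 : R) ^ (invCount σ + invCount μ) = (-1) ^ w.length := by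
        rw [← hw, hpath.1, ← add_assoc, pow_add, ← two_mul, pow_mul, neg_one_sq, one_pow, one_mul]
      simp [hw, hsign, mul_add, add_comm]
    · simp [hw]

end Paths

section FullCoefficients

variable {R : Type*} [CommRing R] {n : ℕ} {σ μ : Perm (Fin n)} {a b : Fin n} {i : Fin (n - 1)}
  {L w w' : List (Fin n × Fin n)}

theorem Cov.mul_swap_ascent (hcov : Cov μ a b) (hne : ¬(a = leftPos i ∧ b = rightPos i))
    (h : μ (leftPos i) < μ (rightPos i)) :
    (μ * swap a b) (leftPos i) < (μ * swap a b) (rightPos i) := by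
  have hinj := μ.injective
  have hlr : (rightPos i).val = (leftPos i).val + 1 := rfl
  revert hcov h
  generalize leftPos i = l, rightPos i = r at *
  simp only [Cov, mul_swap_apply]
  grind

/-- The longer one of `μ` and `μ s_i`. -/
def raise (i : Fin (n - 1)) (μ : Perm (Fin n)) : Perm (Fin n) :=
  if μ (leftPos i) < μ (rightPos i) then μ * simple i else μ

theorem bruhatLE_raise (i : Fin (n - 1)) (μ : Perm (Fin n)) : BruhatLE μ (raise i μ) := by
  unfold raise
  split_ifs with h
  · exact bruhatLE_mul_simple h
  · exact bruhatLE_refl _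

theorem mul_swap_mul_simple (μ : Perm (Fin n)) (a b : Fin n) (i : Fin (n - 1)) :
    μ * swap a b * simple i = μ * simple i * swap (simple i a) (simple i b) := by
  rw [swap_apply_apply, show (simple i)⁻¹ = simple i from swap_inv _ _]
  simp only [← mul_assoc, mul_simple_mul_simple]

theorem Cov.raise_bruhatLE (hcov : Cov μ a b) (i : Fin (n - 1)) :
    BruhatLE (raise i μ) (raise i (μ * swap a b)) := by
  by_cases hasc : μ (leftPos i) < μ (rightPos i)
  · by_cases hab : a = leftPos i ∧ b = rightPos i
    · obtain ⟨rfl, rfl⟩ := hab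
      rw [raise, if_pos hasc]
      exact bruhatLE_raise _ _
    · have hasc' := hcov.mul_swap_ascent hab hasc
      rw [raise, if_pos hasc, raise, if_pos hasc', mul_swap_mul_simple]
      refine Relation.ReflTransGen.single ⟨_,
        ⟨⟨_, _, (simple i).injective.ne hcov.1.ne, rfl⟩, ?_⟩, rfl⟩
      rw [← mul_swap_mul_simple, len_eq_invCount, len_eq_invCount, invCount_mul_simple hasc,
        invCount_mul_simple hasc', hcov.invCount_eq]
  · rw [raise, if_neg hasc]
    exact hcov.bruhatLE.trans (bruhatLE_raise _ _)

theorem BruhatLE.raise (h : BruhatLE σ μ) (i : Fin (n - 1)) :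
    BruhatLE (raise i σ) (raise i μ) :=
  h.cov_induction (P := fun μ => BruhatLE (ZeroHecke.raise i σ) (ZeroHecke.raise i μ))
    (bruhatLE_refl _) fun _ _ _ _ hcov ih => ih.trans (hcov.raise_bruhatLE i)

theorem act_rightPi_sub_apply_K (σ μ : Perm (Fin n)) (i : Fin (n - 1)) :
    (act (K R σ) (rightPi R i) - K R σ) μ =
      if μ (leftPos i) < μ (rightPos i) then K R σ (μ * simple i) else -K R σ μ := by
  have hσμ : σ * simple i = μ ↔ σ = μ * simple i := by
    constructor <;> rintro rfl <;> simp
  have hμ : (μ * simple i) (leftPos i) = μ (rightPos i) := by simp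
  have hμ' : (μ * simple i) (rightPos i) = μ (leftPos i) := by simp
  have hne := apply_leftPos_ne μ i
  rw [act_rightPi]
  split_ifs <;> simp only [Finsupp.sub_apply, K_apply, hσμ] <;> grind

theorem act_rightPi_sub_apply (f : KSpace R n) (i : Fin (n - 1)) (μ : Perm (Fin n)) :
    (act f (rightPi R i) - f) μ =
      if μ (leftPos i) < μ (rightPos i) then f (μ * simple i) else -f μ := by
  induction f using Finsupp.induction_linear with
  | zero => simp
  | add f g hf hg =>
    rw [act_add, add_sub_add_comm, Finsupp.add_apply, hf, hg]
    split_ifs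
    · rfl
    · rw [Finsupp.add_apply, neg_add]
  | single σ r =>
    have hsingle : (Finsupp.single σ r : KSpace R n) = r • K R σ := by simp [K]
    have hact : act (r • K R σ) (rightPi R i) = r • act (K R σ) (rightPi R i) := map_smul _ _ _
    rw [hsingle, hact, ← smul_sub, Finsupp.smul_apply, act_rightPi_sub_apply_K]
    split_ifs <;> simp

theorem BruhatLE.eq_omega (h : BruhatLE (omega n) μ) : μ = omega n :=
  h.cov_induction (P := fun μ => μ = omega n) rfl fun _ _ _ _ hcov hμ => by
    subst hμ
    exact ((Fin.rev_lt_rev.1 hcov.2.1).not_gt hcov.1).elim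

@[elab_as_elim]
theorem ascent_induction {P : Perm (Fin n) → Prop} (σ : Perm (Fin n))
    (step : ∀ σ, (∀ i, σ (leftPos i) < σ (rightPos i) → P (σ * simple i)) → P σ) : P σ := by
  induction hd : invCount (omega n * σ) using Nat.strong_induction_on generalizing σ with
  | _ d ih =>
    refine step σ fun i hasc => ih _ ?_ _ rfl
    have hdesc : (omega n * σ) (rightPos i) < (omega n * σ) (leftPos i) := Fin.rev_lt_rev.2 hasc
    rw [← hd, ← invCount_mul_simple' hdesc, mul_assoc]
    exact Nat.lt_succ_self _

theorem exists_ascent (h : σ ≠ omega n) : ∃ i, σ (leftPos i) < σ (rightPos i) := by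
  obtain ⟨i, hdesc⟩ := exists_descent (σ := omega n * σ) fun heq =>
    h (by rw [← omega_mul_omega_mul σ, heq, mul_one])
  exact ⟨i, Fin.rev_lt_rev.1 hdesc⟩

theorem act_fullProd_apply_of_bruhatLE (h : BruhatLE σ μ) :
    act (K R σ) (fullProd R n) μ = (-1) ^ (invCount σ + invCount μ) := by
  induction σ using ascent_induction generalizing μ with
  | step σ ih =>
    by_cases hσ : σ = omega n
    · subst hσ
      rw [h.eq_omega, act_omega_fullProd, K_apply, if_pos rfl, ← two_mul, pow_mul, neg_one_sq,
        one_pow]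
    · obtain ⟨i, hasc⟩ := exists_ascent hσ
      have hraise := h.raise i
      have hrec := act_mul_simple_fullProd (R := R) (σ := σ * simple i) (i := i)
        (by simpa using hasc)
      rw [mul_simple_mul_simple] at hrec
      rw [hrec, act_rightPi_sub_apply]
      rw [raise, if_pos hasc, raise] at hraise
      split_ifs at hraise ⊢ with hμ
      · rw [ih i hasc hraise, invCount_mul_simple hasc, invCount_mul_simple hμ]
        ring
      · rw [ih i hasc hraise, invCount_mul_simple hasc]
        ring

theorem count_bruhatPaths_eq_one (hL : ∀ p ∈ L, p.1 < p.2)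
    (hfull : fullProd ℤ n = pairProd (chainFactor ℤ) L) (h : BruhatLE σ μ) :
    ((bruhatPaths L σ).map (mulWord σ)).count μ = 1 := by
  have hcoeff := act_fullProd_apply_of_bruhatLE (R := ℤ) h
  rw [hfull, act_pairProd_apply hL, mul_eq_left₀ (pow_ne_zero _ (by norm_num))] at hcoeff
  exact_mod_cast hcoeff

theorem exists_isBruhatPath_of_bruhatLE (hL : ∀ p ∈ L, p.1 < p.2)
    (hfull : fullProd ℤ n = pairProd (chainFactor ℤ) L) (h : BruhatLE σ μ) :
    ∃ w, w.Sublist L ∧ IsBruhatPath σ w ∧ mulWord σ w = μ := by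
  have hmem := List.count_pos_iff.1 ((count_bruhatPaths_eq_one hL hfull h).ge)
  obtain ⟨w, hw, rfl⟩ := List.mem_map.1 hmem
  exact ⟨w, (mem_bruhatPaths.1 hw).1, (mem_bruhatPaths.1 hw).2, rfl⟩

theorem IsBruhatPath.eq_of_mulWord_eq (hL : ∀ p ∈ L, p.1 < p.2)
    (hfull : fullProd ℤ n = pairProd (chainFactor ℤ) L) (hw : IsBruhatPath σ w)
    (hwL : w.Sublist L) (hw' : IsBruhatPath σ w') (hwL' : w'.Sublist L)
    (h : mulWord σ w = mulWord σ w') : w = w' := by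
  by_contra hne
  have hsub : [w, w'] ⊆ bruhatPaths L σ := by
    simp [mem_bruhatPaths, hw, hwL, hw', hwL']
  obtain ⟨l, hperm, hsublist⟩ := List.Nodup.subperm (by simpa using hne) hsub
  have hcount := (hsublist.map (mulWord σ)).count_le (mulWord σ w)
  rw [count_bruhatPaths_eq_one hL hfull hw.bruhatLE, (hperm.map _).count_eq] at hcount
  simp [← h] at hcount

end FullCoefficients

section Cosets

variable {n m : ℕ} {k : Fin m → ℕ} {σ μ ν ζ ζ' : Perm (Fin n)} {a b : Fin n}

/-- The permutations `σ` and `μ` lie in the same left coset of `parabolic k`. -/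
def SameCoset (k : Fin m → ℕ) (σ μ : Perm (Fin n)) : Prop := σ⁻¹ * μ ∈ parabolic (n := n) k

theorem sameCoset_refl (k : Fin m → ℕ) (σ : Perm (Fin n)) : SameCoset k σ σ := by
  rw [SameCoset, inv_mul_cancel]
  exact one_mem _

theorem SameCoset.symm (h : SameCoset k σ μ) : SameCoset k μ σ := by
  simpa [SameCoset] using inv_mem h

theorem SameCoset.trans (h : SameCoset k σ μ) (h' : SameCoset k μ ν) : SameCoset k σ ν := by
  simpa [SameCoset, mul_assoc] using mul_mem h h'

theorem sameCoset_mul_swap (h : SameBlock k a b) (σ : Perm (Fin n)) :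
    SameCoset k σ (σ * swap a b) := by
  rw [SameCoset, inv_mul_cancel_left]
  exact swap_mem_parabolic h

theorem decreasingOnBlocks_of_forall_descent
    (h : ∀ i, SameBlock k (leftPos i) (rightPos i) → ζ (rightPos i) < ζ (leftPos i)) :
    DecreasingOnBlocks k ζ := by
  intro a b hab
  have hmono : StrictMonoOn (omega n * ζ) (Set.Icc a b) := by
    refine strictMonoOn_of_forall_lt Set.ordConnected_Icc fun i hl hr =>
      Fin.rev_lt_rev.2 (h i ⟨leftPos_lt_rightPos i, fun j => ?_⟩)
    have hcut := hab.2 j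
    simp only [Set.mem_Icc, Fin.le_def] at hl hr
    change i.val < k j ↔ i.val + 1 < k j
    omega
  exact Fin.rev_lt_rev.1
    (hmono (Set.left_mem_Icc.2 hab.1.le) (Set.right_mem_Icc.2 hab.1.le) hab.1)

theorem DecreasingOnBlocks.eq_of_sameCoset (hζ : DecreasingOnBlocks k ζ)
    (hζ' : DecreasingOnBlocks k ζ') (h : SameCoset k ζ ζ') : ζ = ζ' := by
  rw [← inv_mul_eq_one]
  by_contra hne
  obtain ⟨i, hdesc⟩ := exists_descent hne
  obtain ⟨himage, hblock⟩ := sameBlock_of_apply_lt h (leftPos_lt_rightPos i) hdesc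
  have hlt : ζ' (leftPos i) < ζ' (rightPos i) := by simpa using hζ _ _ himage
  exact hlt.not_gt (hζ' _ _ hblock)

theorem exists_decreasingOnBlocks (k : Fin m → ℕ) (σ : Perm (Fin n)) :
    ∃ ζ, SameCoset k σ ζ ∧ BruhatLE σ ζ ∧ DecreasingOnBlocks k ζ := by
  induction σ using ascent_induction with
  | step σ ih =>
    by_cases h : ∀ i, SameBlock k (leftPos i) (rightPos i) → σ (rightPos i) < σ (leftPos i)
    · exact ⟨σ, sameCoset_refl k σ, bruhatLE_refl σ, decreasingOnBlocks_of_forall_descent h⟩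
    · push Not at h
      obtain ⟨i, hblock, hle⟩ := h
      have hasc := hle.lt_of_ne (apply_leftPos_ne σ i)
      obtain ⟨ζ, hcoset, hσζ, hζ⟩ := ih i hasc
      exact ⟨ζ, (sameCoset_mul_swap hblock σ).trans hcoset,
        (bruhatLE_mul_simple hasc).trans hσζ, hζ⟩

theorem isCosetMax_iff : IsCosetMax k σ ζ ↔ SameCoset k σ ζ ∧ DecreasingOnBlocks k ζ := by
  constructor
  · intro h
    obtain ⟨ζ', hcoset, hle, hζ'⟩ := exists_decreasingOnBlocks k ζ
    rw [hle.antisymm (h.2 ζ' (SameCoset.trans h.1 hcoset))]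
    exact ⟨SameCoset.trans h.1 hcoset, hζ'⟩
  · rintro ⟨hcoset, hζ⟩
    refine ⟨hcoset, fun μ hμ => ?_⟩
    obtain ⟨ζ', hcoset', hle, hζ'⟩ := exists_decreasingOnBlocks k μ
    rwa [hζ.eq_of_sameCoset hζ' (hcoset.symm.trans (SameCoset.trans hμ hcoset'))]

theorem existsUnique_isCosetMax (k : Fin m → ℕ) (σ : Perm (Fin n)) : ∃! ζ, IsCosetMax k σ ζ := by
  obtain ⟨ζ, hcoset, -, hζ⟩ := exists_decreasingOnBlocks k σ
  refine ⟨ζ, isCosetMax_iff.2 ⟨hcoset, hζ⟩, fun ζ' hζ' => ?_⟩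
  obtain ⟨hcoset', hdecr⟩ := isCosetMax_iff.1 hζ'
  exact hdecr.eq_of_sameCoset hζ (hcoset'.symm.trans hcoset)

theorem BruhatLE.omega_mul (h : BruhatLE σ μ) : BruhatLE (omega n * μ) (omega n * σ) := by
  refine h.cov_induction (P := fun μ => BruhatLE (omega n * μ) (omega n * σ)) (bruhatLE_refl _)
    fun μ a b _ hcov ih => BruhatLE.trans ?_ ih
  have hcov' : Cov (omega n * (μ * swap a b)) a b := by
    have := μ.injective
    revert hcov
    simp only [Cov, Perm.mul_apply (omega n), omega_apply, mul_swap_apply, Fin.rev_lt_rev]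
    grind
  simpa [← mul_assoc] using hcov'.bruhatLE

theorem exists_cosetMin (k : Fin m → ℕ) (σ : Perm (Fin n)) :
    ∃ α, ∀ μ, SameCoset k σ μ → SameCoset k α μ ∧ BruhatLE α μ := by
  obtain ⟨ζ, hζ, -⟩ := existsUnique_isCosetMax k (omega n * σ)
  have homega {σ μ : Perm (Fin n)} (h : SameCoset k σ μ) :
      SameCoset k (omega n * σ) (omega n * μ) := by
    simpa [SameCoset, mul_assoc, omega_mul_omega_mul] using h
  refine ⟨omega n * ζ, fun μ hμ => ⟨?_, ?_⟩⟩
  · have h := homega (SameCoset.symm (hζ.1))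
    rw [omega_mul_omega_mul] at h
    exact h.trans hμ
  · simpa [omega_mul_omega_mul] using (hζ.2 _ (homega hμ)).omega_mul

end Cosets

section CosetInvariants

variable {n m c : ℕ} {k : Fin m → ℕ} {σ τ μ : Perm (Fin n)} {a b : Fin n}
  {w : List (Fin n × Fin n)}

/-- The sum of the first `c` values of `σ`.  It grows along the Bruhat order and, when `c` is one of
the cuts, is constant on the cosets of `parabolic k`. -/
def initialSum (c : ℕ) (σ : Perm (Fin n)) : ℕ := ∑ x : Fin n with x.val < c, (σ x).val

theorem initialSum_mul (hτ : ∀ x, (τ x).val < c ↔ x.val < c) (σ : Perm (Fin n)) :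
    initialSum c (σ * τ) = initialSum c σ :=
  Finset.sum_equiv τ (by simp [hτ]) (by simp)

theorem SameCoset.initialSum_eq (h : SameCoset k σ μ) (j : Fin m) :
    initialSum (k j) μ = initialSum (k j) σ := by
  rw [← initialSum_mul (fun x => h j x) σ, mul_inv_cancel_left]

theorem Cov.apply_le_mul_swap_apply (h : Cov σ a b) {x : Fin n} (hx : x ≠ b) :
    σ x ≤ (σ * swap a b) x := by
  rcases eq_or_ne x a with rfl | hxa
  · simpa using h.2.1.le
  · rw [mul_swap_apply_of_ne σ hxa hx]

theorem Cov.initialSum_le (h : Cov σ a b) (c : ℕ) :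
    initialSum c σ ≤ initialSum c (σ * swap a b) := by
  rcases lt_or_ge b.val c with hb | hb
  · refine (initialSum_mul (fun x => ?_) σ).ge
    have hab := Fin.lt_def.1 h.1
    rw [swap_apply_def]
    split_ifs with hxa hxb
    · subst hxa; omega
    · subst hxb; omega
    · rfl
  · refine Finset.sum_le_sum fun x hx => h.apply_le_mul_swap_apply ?_
    rintro rfl
    exact hb.not_gt (Finset.mem_filter.1 hx).2

theorem Cov.initialSum_lt (h : Cov σ a b) (ha : a.val < c) (hb : c ≤ b.val) :
    initialSum c σ < initialSum c (σ * swap a b) := by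
  refine Finset.sum_lt_sum (fun x hx => h.apply_le_mul_swap_apply ?_)
    ⟨a, by simpa using ha, by simpa using h.2.1⟩
  rintro rfl
  exact hb.not_gt (Finset.mem_filter.1 hx).2

theorem BruhatLE.initialSum_le (h : BruhatLE σ μ) (c : ℕ) : initialSum c σ ≤ initialSum c μ :=
  h.cov_induction (P := fun μ => initialSum c σ ≤ initialSum c μ) le_rfl
    fun _ _ _ _ hcov ih => ih.trans (hcov.initialSum_le c)

theorem IsBruhatPath.eq_nil_of_sameCoset (hpath : IsBruhatPath σ w)
    (hw : ∀ p ∈ w, p.1 < p.2 ∧ ¬SameBlock k p.1 p.2) (h : SameCoset k σ (mulWord σ w)) :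
    w = [] := by
  rcases w with _ | ⟨p, w⟩
  · rfl
  · obtain ⟨hlt, hblock⟩ := hw p List.mem_cons_self
    obtain ⟨hcov, hpath'⟩ := (isBruhatPath_cons hlt).1 hpath
    obtain ⟨j, hj⟩ : ∃ j, p.1.val < k j ∧ k j ≤ p.2.val := by
      by_contra! hcut
      exact hblock ⟨hlt, fun j => ⟨hcut j, (Fin.lt_def.1 hlt).trans⟩⟩
    have hstep := hcov.initialSum_lt hj.1 hj.2
    have hrest := hpath'.bruhatLE.initialSum_le (k j)
    rw [← mulWord_cons, h.initialSum_eq j] at hrest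
    omega

theorem sameCoset_mulWord (hw : ∀ p ∈ w, SameBlock k p.1 p.2) (σ : Perm (Fin n)) :
    SameCoset k σ (mulWord σ w) := by
  induction w generalizing σ with
  | nil => exact sameCoset_refl k σ
  | cons p w ih =>
    rw [List.forall_mem_cons] at hw
    rw [mulWord_cons]
    exact (sameCoset_mul_swap hw.1 σ).trans (ih hw.2 _)

end CosetInvariants

section SummationSet

variable {R : Type*} [CommRing R] {n m : ℕ} {k : Fin m → ℕ} {σ γ μ ν₁ ν₂ : Perm (Fin n)}
  {L w v : List (Fin n × Fin n)}

theorem mem_validSubwords :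
    w ∈ validSubwords k σ ↔ w.Sublist (transpList n k) ∧ IsBruhatPath σ w := by
  simp [validSubwords]

theorem lt_of_mem_append_transpList (hL : ∀ p ∈ L, SameBlock k p.1 p.2) :
    ∀ p ∈ L ++ transpList n k, p.1 < p.2 := by
  intro p hp
  rcases List.mem_append.1 hp with h | h
  · exact (hL p h).1
  · exact (mem_transpList h).1

theorem injOn_mulWord (hk : StrictMono k) (hkn : ∀ j, k j < n) (σ : Perm (Fin n)) :
    Set.InjOn (mulWord σ) (validSubwords k σ : Set (List (Fin n × Fin n))) := by
  intro w hw w' hw' h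
  obtain ⟨L, hL, hfull⟩ := exists_fullProd_eq_pairProd (R := ℤ) hk hkn
  obtain ⟨hsub, hpath⟩ := mem_validSubwords.1 hw
  obtain ⟨hsub', hpath'⟩ := mem_validSubwords.1 hw'
  exact hpath.eq_of_mulWord_eq (lt_of_mem_append_transpList hL) hfull
    (hsub.trans (List.sublist_append_right L _)) hpath'
    (hsub'.trans (List.sublist_append_right L _)) h

theorem exists_append_of_bruhatLE (hL : ∀ p ∈ L, SameBlock k p.1 p.2)
    (hfull : fullProd ℤ n = pairProd (chainFactor ℤ) (L ++ transpList n k))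
    (h : BruhatLE σ μ) : ∃ w v, w.Sublist L ∧ IsBruhatPath σ w ∧
      v ∈ validSubwords k (mulWord σ w) ∧ mulWord (mulWord σ w) v = μ := by
  obtain ⟨_, hsub, hpath, hμ⟩ :=
    exists_isBruhatPath_of_bruhatLE (lt_of_mem_append_transpList hL) hfull h
  obtain ⟨w, v, rfl, hw, hv⟩ := List.sublist_append_iff.1 hsub
  obtain ⟨hpathw, hpathv⟩ := isBruhatPath_append.1 hpath
  exact ⟨w, v, hw, hpathw, mem_validSubwords.2 ⟨hv, hpathv⟩, mulWord_append σ w v ▸ hμ⟩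

theorem exists_mem_summationSet_of_bruhatLE (hk : StrictMono k) (hkn : ∀ j, k j < n)
    (h : BruhatLE σ μ) : ∃ γ, SameCoset k σ γ ∧ BruhatLE σ γ ∧ μ ∈ summationSet k γ := by
  obtain ⟨L, hL, hfull⟩ := exists_fullProd_eq_pairProd (R := ℤ) hk hkn
  obtain ⟨w, v, hw, hpath, hv, hμ⟩ := exists_append_of_bruhatLE hL hfull h
  exact ⟨mulWord σ w, sameCoset_mulWord (fun p hp => hL p (hw.subset hp)) σ, hpath.bruhatLE,
    v, hv, hμ⟩

theorem exists_sublist_of_bruhatLE_of_sameCoset (hL : ∀ p ∈ L, SameBlock k p.1 p.2)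
    (hfull : fullProd ℤ n = pairProd (chainFactor ℤ) (L ++ transpList n k))
    (h : BruhatLE σ γ) (hcoset : SameCoset k σ γ) :
    ∃ w, w.Sublist L ∧ IsBruhatPath σ w ∧ mulWord σ w = γ := by
  obtain ⟨w, v, hw, hpath, hv, rfl⟩ := exists_append_of_bruhatLE hL hfull h
  obtain ⟨hvL, hpathv⟩ := mem_validSubwords.1 hv
  have hcoset' : SameCoset k σ (mulWord σ w) :=
    sameCoset_mulWord (fun p hp => hL p (hw.subset hp)) σ
  obtain rfl := hpathv.eq_nil_of_sameCoset (fun p hp => mem_transpList (hvL.subset hp))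
    (hcoset'.symm.trans hcoset)
  exact ⟨w, hw, hpath, rfl⟩

open Classical in
theorem filter_sameBlock_append (hw : ∀ p ∈ w, SameBlock k p.1 p.2)
    (hv : v.Sublist (transpList n k)) :
    (w ++ v).filter (fun p => SameBlock k p.1 p.2) = w := by
  rw [List.filter_append, List.filter_eq_self.2 (by simpa using hw),
    List.filter_eq_nil_iff.2 fun p hp => by simpa using (mem_transpList (hv.subset hp)).2,
    List.append_nil]

/- Both chains extend, through the minimum `α` of the coset, to subwords of `L ++ 𝒲` leading from
`α` to `μ`; such a subword is unique, and its letters in `L` determine the element of the coset. -/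
theorem eq_of_mem_summationSet (hk : StrictMono k) (hkn : ∀ j, k j < n)
    (hcoset : SameCoset k σ γ) (hσ : μ ∈ summationSet k σ) (hγ : μ ∈ summationSet k γ) : σ = γ := by
  obtain ⟨L, hL, hfull⟩ := exists_fullProd_eq_pairProd (R := ℤ) hk hkn
  obtain ⟨α, hα⟩ := exists_cosetMin k σ
  obtain ⟨hασ, hle⟩ := hα σ (sameCoset_refl k σ)
  obtain ⟨hαγ, hle'⟩ := hα γ hcoset
  obtain ⟨w, hw, hpath, rfl⟩ := exists_sublist_of_bruhatLE_of_sameCoset hL hfull hle hασ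
  obtain ⟨w', hw', hpath', rfl⟩ := exists_sublist_of_bruhatLE_of_sameCoset hL hfull hle' hαγ
  obtain ⟨v, hv, hμ⟩ := hσ
  obtain ⟨v', hv', hμ'⟩ := hγ
  obtain ⟨hsub, hpathv⟩ := mem_validSubwords.1 hv
  obtain ⟨hsub', hpathv'⟩ := mem_validSubwords.1 hv'
  have happend : w ++ v = w' ++ v' :=
    (isBruhatPath_append.2 ⟨hpath, hpathv⟩).eq_of_mulWord_eq (lt_of_mem_append_transpList hL)
      hfull (hw.append hsub) (isBruhatPath_append.2 ⟨hpath', hpathv'⟩) (hw'.append hsub')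
      (by rw [mulWord_append, mulWord_append, hμ, hμ'])
  rw [← filter_sameBlock_append (fun p hp => hL p (hw.subset hp)) hsub, happend,
    filter_sameBlock_append (fun p hp => hL p (hw'.subset hp)) hsub']

theorem mem_summationSet_iff (hk : StrictMono k) (hkn : ∀ j, k j < n) : μ ∈ summationSet k σ ↔
    BruhatLE σ μ ∧ ∀ γ, SameCoset k σ γ → BruhatLE γ μ → BruhatLE γ σ := by
  constructor
  · intro hμ
    obtain ⟨w, hw, rfl⟩ := id hμ
    refine ⟨(mem_validSubwords.1 hw).2.bruhatLE, fun γ hγ hle => ?_⟩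
    obtain ⟨δ, hδ, hγδ, hμδ⟩ := exists_mem_summationSet_of_bruhatLE hk hkn hle
    rwa [eq_of_mem_summationSet hk hkn (hγ.trans hδ) hμ hμδ]
  · rintro ⟨hle, hmax⟩
    obtain ⟨γ, hγ, hσγ, hμ⟩ := exists_mem_summationSet_of_bruhatLE hk hkn hle
    obtain ⟨w, hw, rfl⟩ := id hμ
    rwa [hσγ.antisymm (hmax γ hγ (mem_validSubwords.1 hw).2.bruhatLE)]

theorem summationSet_convex (hk : StrictMono k) (hkn : ∀ j, k j < n)
    (hν₁ : ν₁ ∈ summationSet k σ) (hν₂ : ν₂ ∈ summationSet k σ)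
    (hle₁ : BruhatLE ν₁ μ) (hle₂ : BruhatLE μ ν₂) : μ ∈ summationSet k σ := by
  rw [mem_summationSet_iff hk hkn] at hν₁ hν₂ ⊢
  exact ⟨hν₁.1.trans hle₁, fun γ hγ hle => hν₂.2 γ hγ (hle.trans hle₂)⟩

theorem chainSum_apply_mulWord (hk : StrictMono k) (hkn : ∀ j, k j < n)
    (hw : w ∈ validSubwords k σ) : chainSum R k σ (mulWord σ w) = (-1) ^ w.length := by
  rw [chainSum, Finsupp.finsetSum_apply, Finset.sum_eq_single_of_mem w hw]
  · simp [K_apply]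
  · intro v hv hne
    simp [K_apply, (injOn_mulWord hk hkn σ).ne hv hw hne]

theorem chainSum_apply_of_notMem (hμ : μ ∉ summationSet k σ) : chainSum R k σ μ = 0 := by
  rw [chainSum, Finsupp.finsetSum_apply]
  refine Finset.sum_eq_zero fun w hw => ?_
  have hne : mulWord σ w ≠ μ := fun h => hμ ⟨w, hw, h⟩
  simp [K_apply, hne]

theorem chainSum_apply_eq_one_or (hk : StrictMono k) (hkn : ∀ j, k j < n)
    (hμ : μ ∈ summationSet k σ) : chainSum R k σ μ = 1 ∨ chainSum R k σ μ = -1 := by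
  obtain ⟨w, hw, rfl⟩ := hμ
  rw [chainSum_apply_mulWord hk hkn hw]
  exact neg_one_pow_eq_or R _

theorem support_chainSum [Nontrivial R] (hk : StrictMono k) (hkn : ∀ j, k j < n)
    (σ : Perm (Fin n)) :
    ((chainSum R k σ).support : Set (Perm (Fin n))) = summationSet k σ := by
  ext μ
  rw [Finset.mem_coe, Finsupp.mem_support_iff]
  refine ⟨not_imp_comm.1 chainSum_apply_of_notMem, fun hμ => ?_⟩
  rcases chainSum_apply_eq_one_or (R := R) hk hkn hμ with h | h <;> simp [h]

end SummationSet

section NonInterval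

variable {n m : ℕ} {k : Fin m → ℕ} {σ : Perm (Fin n)}

instance (σ : Perm (Fin n)) (w : List (Fin n × Fin n)) : Decidable (IsBruhatPath σ w) := by
  induction w generalizing σ with
  | nil => exact .isTrue trivial
  | cons p w ih =>
    have := ih (σ * swap p.1 p.2)
    exact decidable_of_iff' _ (and_congr isBruhatTransposition_swap_iff Iff.rfl)

theorem not_interval_of_two_maximal {w w' : List (Fin n × Fin n)} (hw : w ∈ validSubwords k σ)
    (hw' : w' ∈ validSubwords k σ) (hne : mulWord σ w ≠ mulWord σ w')
    (hlong : ∀ v ∈ validSubwords k σ, v.length ≤ w.length ∧ v.length ≤ w'.length) :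
    ¬∃ α β : Perm (Fin n), summationSet k σ = {μ | BruhatLE α μ ∧ BruhatLE μ β} := by
  rintro ⟨α, β, hset⟩
  have hmem : mulWord σ w ∈ {μ | BruhatLE α μ ∧ BruhatLE μ β} := hset ▸ ⟨w, hw, rfl⟩
  have hmem' : mulWord σ w' ∈ {μ | BruhatLE α μ ∧ BruhatLE μ β} := hset ▸ ⟨w', hw', rfl⟩
  obtain ⟨v, hv, rfl⟩ : β ∈ summationSet k σ :=
    hset ▸ ⟨hmem.1.trans hmem.2, bruhatLE_refl β⟩
  have htop {u : List (Fin n × Fin n)} (hu : u ∈ validSubwords k σ)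
      (hle : BruhatLE (mulWord σ u) (mulWord σ v)) (hlen : v.length ≤ u.length) :
      mulWord σ u = mulWord σ v := by
    refine hle.eq_or_invCount_lt.resolve_right ?_
    rw [(mem_validSubwords.1 hu).2.invCount_mulWord, (mem_validSubwords.1 hv).2.invCount_mulWord]
    omega
  exact hne ((htop hw hmem.2 (hlong v hv).1).trans (htop hw' hmem'.2 (hlong v hv).2).symm)

theorem exists_not_interval : ∃ (n m : ℕ) (k : Fin m → ℕ) (σ : Perm (Fin n)),
    StrictMono k ∧ (∀ j, 1 ≤ k j ∧ k j < n) ∧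
      ¬∃ α β : Perm (Fin n), summationSet k σ = {μ | BruhatLE α μ ∧ BruhatLE μ β} := by
  have hlist : transpList 4 ![1, 3] = [(1, 3), (2, 3), (0, 3), (0, 2), (0, 1)] := by decide
  have hvalid {w : List (Fin 4 × Fin 4)} : w ∈ validSubwords ![1, 3] (swap 0 1 * swap 2 3) ↔
      w ∈ [(1, 3), (2, 3), (0, 3), (0, 2), (0, 1)].sublists ∧
        IsBruhatPath (swap 0 1 * swap 2 3) w := by
    rw [mem_validSubwords, hlist, List.mem_sublists]
  have hshort : ∀ w ∈ [(1, 3), (2, 3), (0, 3), (0, 2), (0, 1)].sublists,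
      IsBruhatPath (n := 4) (swap 0 1 * swap 2 3) w → w.length ≤ 2 := by decide
  refine ⟨4, 2, ![1, 3], swap 0 1 * swap 2 3, by decide, by decide, ?_⟩
  refine not_interval_of_two_maximal (w := [(0, 3), (0, 2)]) (w' := [(1, 3), (0, 1)])
    (hvalid.2 (by decide)) (hvalid.2 (by decide)) (by decide) fun v hv => ?_
  have hle := hshort v (hvalid.1 hv).1 (hvalid.1 hv).2
  exact ⟨hle, hle⟩

end NonInterval

end ZeroHecke

open ZeroHecke in
theorem proposition4p4p3 {R : Type*} [CommRing R] [Nontrivial R] :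
    (∀ (n m : ℕ) (k : Fin m → ℕ), StrictMono k → (∀ j, 1 ≤ k j ∧ k j < n) →
      ∀ σ : Equiv.Perm (Fin n),
        -- the coset has exactly one maximal element
        (∃! ζ : Equiv.Perm (Fin n), IsCosetMax k σ ζ) ∧
        -- the expansion, for all reduced decompositions `u` of `ω ζ` and `v` of `ζ⁻¹ σ`
        (∀ ζ : Equiv.Perm (Fin n), IsCosetMax k σ ζ →
          ∀ u v : List (Fin (n - 1)),
            IsReducedWord u (omega n * ζ) → IsReducedWord v (ζ⁻¹ * σ) →
              piWord (piHatWord (K R (omega n)) u) v = chainSum R k σ) ∧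
        -- no cancellation: each permutation is reached by at most one valid subword
        Set.InjOn (mulWord σ) (validSubwords k σ : Set (List (Fin n × Fin n))) ∧
        -- the permutations occurring in the sum, with coefficients `1` or `-1`
        (((chainSum R k σ).support : Set (Equiv.Perm (Fin n))) = summationSet k σ) ∧
        (∀ ν ∈ summationSet k σ, chainSum R k σ ν = 1 ∨ chainSum R k σ ν = -1) ∧
        -- closure under intervals
        (∀ ν₁ ∈ summationSet k σ, ∀ ν₂ ∈ summationSet k σ, ∀ μ : Equiv.Perm (Fin n),
          BruhatLE ν₁ μ → BruhatLE μ ν₂ → μ ∈ summationSet k σ)) ∧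
    -- in general the set is not an interval
    (∃ (n m : ℕ) (k : Fin m → ℕ) (σ : Equiv.Perm (Fin n)),
      StrictMono k ∧ (∀ j, 1 ≤ k j ∧ k j < n) ∧
        ¬ ∃ α β : Equiv.Perm (Fin n),
          summationSet k σ = {μ | BruhatLE α μ ∧ BruhatLE μ β}) := by
  refine ⟨fun n m k hk hkn σ => ?_, exists_not_interval⟩
  have hlt : ∀ j, k j < n := fun j => (hkn j).2
  refine ⟨existsUnique_isCosetMax k σ, fun ζ hζ u v hu hv => ?_, injOn_mulWord hk hlt σ,
    support_chainSum hk hlt σ, fun ν hν => chainSum_apply_eq_one_or hk hlt hν,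
    fun ν₁ hν₁ ν₂ hν₂ μ => summationSet_convex hk hlt hν₁ hν₂⟩
  obtain ⟨hcoset, hdecr⟩ := isCosetMax_iff.1 hζ
  rw [chainSum_eq_act hk]
  exact piWord_piHatWord_omega hk hlt hdecr hcoset.symm hu hv
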